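/- **Theorem 1.2 (first two moments).** Let $A_1,A_2$ be complex $N\times N$ matrices with $A_1$ normal, and write $$\det(x_1A_1+x_2A_2-x_3I)=c\prod_{j=1}^s R_j(x_1,x_2,x_3)^{m_j},\qquad c\neq 0,\ m_j\ge 1,$$ with $R_1,\dots,R_s$ irreducible and pairwise non-proportional polynomials. For $\mu\in\sigma(A_1)$ put $p_\mu=(1/\mu,0,1)$ if $\mu\neq0$, $p_0=(1,0,0)$, and $I_\mu=\{j:\ R_j(p_\mu)=0\}$. Suppose that the following regularity conditions hold at every $\mu\in\sigma(A_1)$: * if $\mu\ne0$: $\frac{\partial R_j}{\partial x_1}(p_\mu)\neq0$ for $j\in I_\mu$, and for distinct $i,j\in I_\mu$ the vectors $\big(\frac{\partial R_i}{\partial x_1},\frac{\partial R_i}{\partial x_2}\big)(p_\mu)$ and $\big(\frac{\partial R_j}{\partial x_1},\frac{\partial R_j}{\partial x_2}\big)(p_\mu)$ are not proportional; * if $\mu=0$: $\frac{\partial R_j}{\partial x_3}(p_0)\neq0$ for $j\in I_0$, and for distinct $i,j\in I_0$ the vectors $\big(\frac{\partial R_i}{\partial x_2},\frac{\partial R_i}{\partial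 x_3}\big)(p_0)$ and $\big(\frac{\partial R_j}{\partial x_2},\frac{\partial R_j}{\partial x_3}\big)(p_0)$ are not proportional. Let $\lambda\in\sigma(A_1)$ be such that $m_j=1$ for all $j\in I_\lambda$, let $j\in I_\lambda$, and let $T_\lambda=\sum_{\mu\in\sigma(A_1),\,\mu\ne\lambda}\frac{\mathscr P_\mu}{\lambda-\mu}$, where $\mathscr P_\mu$ is the orthogonal projection onto the $\mu$-eigenspace of $A_1$. (i) Let $\lambda\neq0$. There is an analytic function $x_{1,\lambda,j}$ near $0\in\mathbb C$ with $x_{1,\lambda,j}(0)=1/\lambda$ and $R_j(x_{1,\lambda,j}(t),t,1)=0$ for $t$ near $0$. For any such function and for small $t\neq0$ let $$P_{j,\lambda}(t)=\frac1{2\pi i}\oint_{|w-1|=\delta(t)}\big(w-x_{1,\lambda,j}(t)A_1-tA_2\big)^{-1}dw,$$ where $\delta(t)>0$ is so small that no eigenvalue of $x_{1,\lambda,j}(t)A_1+tA_2$ other than $1$ satisfies $|w-1|\le\delta(t)$. Then the limit $\mathcal P_{j,\lambda}=\lim_{t\to0}P_{j,\lambda}(t)$ exists and $$\mathcal P_{j,\lambda}A_2\mathcal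 P_{j,\lambda}=-\lambda\,x_{1,\lambda,j}'(0)\,\mathcal P_{j,\lambda},\qquad \mathcal P_{j,\lambda}A_2T_\lambda A_2\mathcal P_{j,\lambda}=-\frac{x_{1,\lambda,j}''(0)}2\,\mathcal P_{j,\lambda}.$$ (ii) Let $\lambda=0$. There is an analytic function $x_{3,0,j}$ near $0\in\mathbb C$ with $x_{3,0,j}(0)=0$ and $R_j(1,t,x_{3,0,j}(t))=0$ for $t$ near $0$. For any such function and for small $t\ne0$ let $$P_{j,0}(t)=\frac1{2\pi i}\oint_{|w|=\delta(t)}\big(w-(A_1+tA_2-x_{3,0,j}(t)I)\big)^{-1}dw,$$ where $\delta(t)>0$ is so small that no non-zero eigenvalue of $A_1+tA_2-x_{3,0,j}(t)I$ satisfies $|w|\le\delta(t)$. Then the limit $\mathcal P_{j,0}=\lim_{t\to0}P_{j,0}(t)$ exists and $$\mathcal P_{j,0}A_2\mathcal P_{j,0}=x_{3,0,j}'(0)\,\mathcal P_{j,0},\qquad \mathcal P_{j,0}A_2T_0A_2\mathcal P_{j,0}=\frac{x_{3,0,j}''(0)}2\,\mathcal P_{j,0}.$$ -/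

import Mathlib

open Filter Topology

noncomputable section

/-- The homogeneous polynomial `det (x₁ A₁ + x₂ A₂ - x₃ I)` in the three variables
`x₁ = X 0`, `x₂ = X 1`, `x₃ = X 2`, whose zero set is the projective joint spectrum
of `(A₁, A₂, -I)`. -/
def pencilDet {N : ℕ} (A₁ A₂ : Matrix (Fin N) (Fin N) ℂ) : MvPolynomial (Fin 3) ℂ :=
  Matrix.det
    ((MvPolynomial.X 0 : MvPolynomial (Fin 3) ℂ) • A₁.map MvPolynomial.C
      + (MvPolynomial.X 1 : MvPolynomial (Fin 3) ℂ) • A₂.map MvPolynomial.C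
      - (MvPolynomial.X 2 : MvPolynomial (Fin 3) ℂ) •
        (1 : Matrix (Fin N) (Fin N) (MvPolynomial (Fin 3) ℂ)))

/-- `f = R₁ ^ m₁ ⋯ R_s ^ m_s` up to a non-zero constant, where the `R_j` are irreducible and
pairwise non-proportional and the multiplicities `m_j` are positive. -/
structure IsIrreducibleFactorization (f : MvPolynomial (Fin 3) ℂ) {s : ℕ}
    (R : Fin s → MvPolynomial (Fin 3) ℂ) (m : Fin s → ℕ) : Prop where
  irreducible : ∀ j, Irreducible (R j)
  not_associated : ∀ i j, i ≠ j → ¬ Associated (R i) (R j)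
  mult_pos : ∀ j, 0 < m j
  associated_prod : Associated f (∏ j, R j ^ m j)

/-- The point of the joint spectrum attached to an eigenvalue `μ` of `A₁`, in the coordinates
`(x₁, x₂, x₃)`: it is `(1/μ, 0, 1)` (chart `x₃ = 1`) if `μ ≠ 0` and `(1, 0, 0)`
(chart `x₁ = 1`) if `μ = 0`. -/
def basePoint (μ : ℂ) : Fin 3 → ℂ :=
  if μ = 0 then ![1, 0, 0] else ![1 / μ, 0, 1]

/-- The index set `I_μ` of the components that pass through the point attached to `μ`. -/
def componentsThrough {s : ℕ} (R : Fin s → MvPolynomial (Fin 3) ℂ) (μ : ℂ) : Set (Fin s) :=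
  {j | MvPolynomial.eval (basePoint μ) (R j) = 0}

/-- The value of `∂R/∂x_k` at the point attached to `μ`, with `k = 0, 1, 2` standing for
`x₁, x₂, x₃`. -/
def partialAt (R : MvPolynomial (Fin 3) ℂ) (μ : ℂ) (k : Fin 3) : ℂ :=
  MvPolynomial.eval (basePoint μ) (MvPolynomial.pderiv k R)

/-- The regularity conditions at an eigenvalue `μ` of `A₁`. For `μ ≠ 0` (chart `x₃ = 1`):
`∂R_j/∂x₁ ≠ 0` for `j ∈ I_μ`, and the gradients `(∂R_j/∂x₁, ∂R_j/∂x₂)`, `j ∈ I_μ`, are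
pairwise non-proportional. For `μ = 0` (chart `x₁ = 1`): the same with `∂R_j/∂x₃` and
with the gradients `(∂R_j/∂x₂, ∂R_j/∂x₃)`. -/
def RegularAt {s : ℕ} (R : Fin s → MvPolynomial (Fin 3) ℂ) (μ : ℂ) : Prop :=
  (μ ≠ 0 →
    (∀ j ∈ componentsThrough R μ, partialAt (R j) μ 0 ≠ 0) ∧
    (∀ i ∈ componentsThrough R μ, ∀ j ∈ componentsThrough R μ, i ≠ j →
      LinearIndependent ℂ ![![partialAt (R i) μ 0, partialAt (R i) μ 1],
        ![partialAt (R j) μ 0, partialAt (R j) μ 1]])) ∧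
  (μ = 0 →
    (∀ j ∈ componentsThrough R μ, partialAt (R j) μ 2 ≠ 0) ∧
    (∀ i ∈ componentsThrough R μ, ∀ j ∈ componentsThrough R μ, i ≠ j →
      LinearIndependent ℂ ![![partialAt (R i) μ 1, partialAt (R i) μ 2],
        ![partialAt (R j) μ 1, partialAt (R j) μ 2]]))

/-- `x` is (near `0`) the analytic function `x₁ = x_{1,μ,j}(x₂)`, `μ ≠ 0`, that describes the
component `{R = 0}` near `(1/μ, 0)` in the chart `x₃ = 1`. -/
structure IsBranch (R : MvPolynomial (Fin 3) ℂ) (μ : ℂ) (x : ℂ → ℂ) : Prop where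
  analyticAt : AnalyticAt ℂ x 0
  map_zero : x 0 = 1 / μ
  eval_eq_zero : ∀ᶠ t in 𝓝 (0 : ℂ), MvPolynomial.eval ![x t, t, 1] R = 0

/-- `x` is (near `0`) the analytic function `x₃ = x_{3,0,j}(x₂)` that describes the
component `{R = 0}` near `(0, 0)` in the chart `x₁ = 1`. -/
structure IsBranchAtZero (R : MvPolynomial (Fin 3) ℂ) (x : ℂ → ℂ) : Prop where
  analyticAt : AnalyticAt ℂ x 0
  map_zero : x 0 = 0
  eval_eq_zero : ∀ᶠ t in 𝓝 (0 : ℂ), MvPolynomial.eval ![1, t, x t] R = 0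

/-- The contour integral `(2πi)⁻¹ ∮_{|w - z| = δ} (w - A)⁻¹ dw`, taken entrywise. -/
def contourProjection {N : ℕ} (A : Matrix (Fin N) (Fin N) ℂ) (z : ℂ) (δ : ℝ) :
    Matrix (Fin N) (Fin N) ℂ :=
  Matrix.of fun a b =>
    (2 * (Real.pi : ℂ) * Complex.I)⁻¹ *
      ∮ w in C(z, δ), ((w • (1 : Matrix (Fin N) (Fin N) ℂ) - A)⁻¹) a b

/-- No eigenvalue of `A` other than (possibly) `z` lies in the closed `δ`-disk about `z`. -/
def IsSeparatingRadius {N : ℕ} (A : Matrix (Fin N) (Fin N) ℂ) (z : ℂ) (δ : ℝ) : Prop :=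
  0 < δ ∧ ∀ μ ∈ spectrum ℂ A, μ ≠ z → δ < ‖μ - z‖

/-- Separating radii always exist. -/
theorem exists_isSeparatingRadius {N : ℕ} (A : Matrix (Fin N) (Fin N) ℂ) (z : ℂ) :
    ∃ δ : ℝ, IsSeparatingRadius A z δ := by
  have hfin : (spectrum ℂ A \ {z}).Finite := (Matrix.finite_spectrum A).subset Set.sdiff_subset
  have hnhds : (spectrum ℂ A \ {z})ᶜ ∈ 𝓝 z :=
    hfin.isClosed.isOpen_compl.mem_nhds (fun h => h.2 rfl)
  obtain ⟨ε, hε, hball⟩ := Metric.mem_nhds_iff.1 hnhds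
  refine ⟨ε / 2, half_pos hε, fun μ hμ hne => ?_⟩
  by_contra hcon
  have hmem : μ ∈ Metric.ball z ε := by
    rw [Metric.mem_ball, dist_eq_norm]
    linarith
  exact hball hmem ⟨hμ, hne⟩

/-- The matrix of the orthogonal projection of `ℂ^N` onto the `μ`-eigenspace of `A`. -/
def eigenProjection {N : ℕ} (A : Matrix (Fin N) (Fin N) ℂ) (μ : ℂ) :
    Matrix (Fin N) (Fin N) ℂ :=
  (Matrix.toEuclideanCLM (n := Fin N) (𝕜 := ℂ)).symm
    (Module.End.eigenspace (Matrix.toEuclideanLin A) μ).starProjection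

/-- `T_lam`, the sum of `(lam - μ)⁻¹ 𝒫_μ` over the eigenvalues `μ ≠ lam` of `A`. -/
def reducedResolvent {N : ℕ} (A : Matrix (Fin N) (Fin N) ℂ) (lam : ℂ) :
    Matrix (Fin N) (Fin N) ℂ :=
  ∑ μ ∈ (Matrix.finite_spectrum A).toFinset.erase lam, (lam - μ)⁻¹ • eigenProjection A μ

/-- `P` is the limit, as `t → 0` with `t ≠ 0`, of the projections
`(2πi)⁻¹ ∮_{|w - z| = δ(t)} (w - A(t))⁻¹ dw`, for every choice of radii `δ(t)` so small that
`z` is the only eigenvalue of `A(t)` in the closed `δ(t)`-disk about `z`. -/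
def IsLimitProjection {N : ℕ} (A : ℂ → Matrix (Fin N) (Fin N) ℂ) (z : ℂ)
    (P : Matrix (Fin N) (Fin N) ℂ) : Prop :=
  ∀ δ : ℂ → ℝ, (∀ᶠ t in 𝓝[≠] (0 : ℂ), IsSeparatingRadius (A t) z (δ t)) →
    Tendsto (fun t => contourProjection (A t) z (δ t)) (𝓝[≠] (0 : ℂ)) (𝓝 P)

end

/-!
Put `K(t) = A(t) - z`, where `A(t) = x(t) A₁ + t A₂`, `z = 1` in the chart `x₃ = 1`, and
`A(t) = A₁ + t A₂ - x(t)`, `z = 0` in the chart `x₁ = 1`. Along the branch `det K(t) = 0`, so `z` is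
an eigenvalue of `A(t)`.

If `z` is a simple root of `D(w) = det (A - w)`, Cauchy's formula applied to
`(w - A)⁻¹ = -adj (A - w) / D(w)` gives the projection of `A` as `-adj (A - z) / D'(z)`
(`contourProjection_eq`). Here `D'(z)` is the value `g(t)` of `∂f/∂x₃` along the branch, with
`f = det (x₁ A₁ + x₂ A₂ - x₃)`. The limit at `t = 0` exists because numerator and denominator vanish
to matching order:

* Let `k = dim ker K(0)`. As `A₁` is normal, it is diagonalizable (`exists_diagonalization`), so up
  to a change of basis `k` rows of `K(t)` are divisible by `t`, and `adj K(t)` is divisible by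
  `t ^ (k - 1)` (`exists_adjugate_eq_pow_smul`).
* Exactly `k` components pass through the base point: both numbers are the order of vanishing of `f`
  along the line `x₂ = 0` (`card_components_eq_card_kernel`).
* By the product rule, a first partial derivative of `f` along the `j`-th branch is that of `R_j`
  times the product of the other components. Those through the base point are transversal to the
  branch, hence have simple zeros on it, and the order is `k - 1` (`analyticOrderAt_eval_pderiv`).
  For `lam ≠ 0` the regularity condition concerns `∂/∂x₁`; Euler's identity for the homogeneous
  polynomial `f` transfers the order to `∂/∂x₃`.

Hence the projections extend to an analytic `P(t)` with `K P = P K = 0` and `P² = P`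
(`exists_analytic_limitProjection`). Write `K(t) = K₀ + t K₁ + t² K₂(t)` and let `S` satisfy
`K₀ S K₀ = K₀`. Comparing coefficients up to order two yields `P(0) K₁ P(0) = 0` and
`P(0) K₁ S K₁ P(0) = P(0) K₂(0) P(0)` (`limitProjection_identities`). With
`S = -lam T_lam` (for `lam ≠ 0`) or `S = -T_0`, these are the two moment formulas.
-/

open Filter Topology

noncomputable section

/-! ### Analytic families of matrices -/

/-- Analyticity of a matrix-valued function at `z`, stated entrywise because matrices carry no
global norm. -/
def EntrywiseAnalyticAt {N : ℕ} (K : ℂ → Matrix (Fin N) (Fin N) ℂ) (z : ℂ) : Prop :=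
  ∀ a b, AnalyticAt ℂ (fun t => K t a b) z

namespace EntrywiseAnalyticAt

variable {N : ℕ} {K L : ℂ → Matrix (Fin N) (Fin N) ℂ} {z : ℂ}

theorem const (M : Matrix (Fin N) (Fin N) ℂ) : EntrywiseAnalyticAt (fun _ => M) z :=
  fun _ _ => analyticAt_const

theorem mul (hK : EntrywiseAnalyticAt K z) (hL : EntrywiseAnalyticAt L z) :
    EntrywiseAnalyticAt (fun t => K t * L t) z := fun a b => by
  simp only [Matrix.mul_apply]
  exact Finset.analyticAt_fun_sum _ fun c _ => (hK a c).mul (hL c b)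

theorem smul {f : ℂ → ℂ} (hf : AnalyticAt ℂ f z) (hK : EntrywiseAnalyticAt K z) :
    EntrywiseAnalyticAt (fun t => f t • K t) z := fun a b => hf.mul (hK a b)

theorem add (hK : EntrywiseAnalyticAt K z) (hL : EntrywiseAnalyticAt L z) :
    EntrywiseAnalyticAt (fun t => K t + L t) z := fun a b => (hK a b).add (hL a b)

theorem sub (hK : EntrywiseAnalyticAt K z) (hL : EntrywiseAnalyticAt L z) :
    EntrywiseAnalyticAt (fun t => K t - L t) z := fun a b => (hK a b).sub (hL a b)

theorem det (hK : EntrywiseAnalyticAt K z) : AnalyticAt ℂ (fun t => (K t).det) z := by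
  simp only [Matrix.det_apply']
  exact Finset.analyticAt_fun_sum _ fun σ _ =>
    analyticAt_const.mul (Finset.analyticAt_fun_prod _ fun i _ => hK _ _)

theorem adjugate (hK : EntrywiseAnalyticAt K z) :
    EntrywiseAnalyticAt (fun t => (K t).adjugate) z := fun a b => by
  simp only [Matrix.adjugate_apply]
  refine det fun c d => ?_
  by_cases h : c = b
  · subst h
    simpa using analyticAt_const
  · simpa [Matrix.updateRow_ne h] using hK c d

theorem continuousAt (hK : EntrywiseAnalyticAt K z) : ContinuousAt K z :=
  continuousAt_pi.2 fun a => continuousAt_pi.2 fun b => (hK a b).continuousAt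

end EntrywiseAnalyticAt

theorem AnalyticAt.dslope_self {f : ℂ → ℂ} {z : ℂ} (hf : AnalyticAt ℂ f z) :
    AnalyticAt ℂ (dslope f z) z := by
  obtain ⟨p, hp⟩ := hf
  exact ⟨_, hp.has_fpower_series_dslope_fslope⟩

/-- If `K 0` is diagonalizable with kernel of dimension at least `n + 1`, then `adj K` is divisible by
`t ^ n`: in an eigenbasis of `K 0`, every row of a zero eigenvalue is divisible by `t`, and the
adjugate of a diagonal matrix misses at most one of these factors. -/
theorem exists_adjugate_eq_pow_smul {N : ℕ} {K : ℂ → Matrix (Fin N) (Fin N) ℂ}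
    (hK : EntrywiseAnalyticAt K 0) {U V : Matrix (Fin N) (Fin N) ℂ} (hVU : V * U = 1)
    {d : Fin N → ℂ} (h0 : K 0 = U * Matrix.diagonal d * V) {n : ℕ}
    (hn : n + 1 ≤ (Finset.univ.filter fun i => d i = 0).card) :
    ∃ C : ℂ → Matrix (Fin N) (Fin N) ℂ, EntrywiseAnalyticAt C 0 ∧
      ∀ t, (K t).adjugate = t ^ n • C t := by
  have hUV : U * V = 1 := mul_eq_one_comm.1 hVU
  set X : ℂ → Matrix (Fin N) (Fin N) ℂ := fun t => V * K t * U with hX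
  have hXa : EntrywiseAnalyticAt X 0 := ((EntrywiseAnalyticAt.const V).mul hK).mul (.const U)
  have hX0 : X 0 = Matrix.diagonal d := by
    simp only [hX, h0]
    calc V * (U * Matrix.diagonal d * V) * U = (V * U) * Matrix.diagonal d * (V * U) := by
          simp only [mul_assoc]
      _ = _ := by rw [hVU, one_mul, mul_one]
  have hKX : ∀ t, K t = U * X t * V := fun t => by
    simp only [hX]
    calc K t = (U * V) * K t * (U * V) := by rw [hUV, one_mul, mul_one]
      _ = _ := by simp only [mul_assoc]
  -- `X t = diagonal (v t) * Y t`: a factor `t` is split off every row that vanishes at `0`.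
  set Y : ℂ → Matrix (Fin N) (Fin N) ℂ := fun t => Matrix.of fun i j =>
    if d i = 0 then dslope (fun t => X t i j) 0 t else X t i j with hY
  have hYa : EntrywiseAnalyticAt Y 0 := fun i j => by
    by_cases h : d i = 0
    · simpa [hY, h] using (hXa i j).dslope_self
    · simpa [hY, h] using hXa i j
  set v : ℂ → Fin N → ℂ := fun t i => if d i = 0 then t else 1 with hv
  have hXY : ∀ t, X t = Matrix.diagonal (v t) * Y t := fun t => by
    ext i j
    rw [Matrix.diagonal_mul]
    by_cases h : d i = 0
    · have h1 : X 0 i j = 0 := by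
        rw [hX0]
        by_cases hij : i = j
        · subst hij; simp [h]
        · simp [hij]
      have h2 := sub_smul_dslope_of_zero (f := fun t => X t i j) (a := 0) h1 t
      simp only [sub_zero, smul_eq_mul] at h2
      simp [hY, hv, h, h2]
    · simp [hY, hv, h]
  set e : Fin N → ℕ := fun i => (((Finset.univ.erase i).filter fun i => d i = 0).card) with he
  have hen : ∀ i, n ≤ e i := fun i => by
    have h1 : (Finset.univ.erase i).filter (fun i => d i = 0) =
        (Finset.univ.filter fun i => d i = 0).erase i := by
      ext; simp [and_comm]
    have := Finset.pred_card_le_card_erase (s := Finset.univ.filter fun i => d i = 0) (a := i)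
    simp only [he, h1]
    omega
  refine ⟨fun t => V.adjugate * ((Y t).adjugate * Matrix.diagonal (fun i => t ^ (e i - n))) *
    U.adjugate, ?_, fun t => ?_⟩
  · refine ((EntrywiseAnalyticAt.const _).mul (hYa.adjugate.mul fun i j => ?_)).mul (.const _)
    by_cases hij : i = j
    · subst hij; simpa using analyticAt_id.fun_pow _
    · simpa [hij] using analyticAt_const
  · have h1 : (Matrix.diagonal (v t)).adjugate =
        t ^ n • Matrix.diagonal (fun i => t ^ (e i - n)) := by
      rw [Matrix.adjugate_diagonal, ← Matrix.diagonal_smul]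
      congr 1
      funext i
      simp only [hv, Pi.smul_apply, smul_eq_mul]
      rw [← pow_add, Nat.add_sub_cancel' (hen i), Finset.prod_ite]
      simp [he]
    rw [hKX, hXY]
    simp only [Matrix.adjugate_mul_distrib, h1, Matrix.mul_smul, Matrix.smul_mul, mul_assoc]

/-! ### The contour integral at a simple eigenvalue -/

/-- Cauchy's integral formula for `(w - A)⁻¹ = -adj (A - w) / det (A - w)` at a simple root `z` of
the denominator. -/
theorem contourProjection_eq {N : ℕ} {A : Matrix (Fin N) (Fin N) ℂ} {z d : ℂ}
    (hdet : (A - z • (1 : Matrix (Fin N) (Fin N) ℂ)).det = 0)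
    (hd : HasDerivAt (fun w => (A - w • (1 : Matrix (Fin N) (Fin N) ℂ)).det) d z) (hd0 : d ≠ 0)
    {δ : ℝ} (hδ : IsSeparatingRadius A z δ) :
    contourProjection A z δ = -d⁻¹ • (A - z • (1 : Matrix (Fin N) (Fin N) ℂ)).adjugate := by
  have hlin : ∀ w, EntrywiseAnalyticAt (fun w => A - w • (1 : Matrix (Fin N) (Fin N) ℂ)) w :=
    fun w => (EntrywiseAnalyticAt.const A).sub (.smul (f := fun w => w) (by fun_prop) (.const 1))
  set D : ℂ → ℂ := fun w => (A - w • (1 : Matrix (Fin N) (Fin N) ℂ)).det with hD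
  have hDa : ∀ w, AnalyticAt ℂ D w := fun w => (hlin w).det
  have hspec : ∀ w, w ∈ spectrum ℂ A ↔ D w = 0 := fun w => by
    rw [spectrum.mem_iff, Matrix.isUnit_iff_isUnit_det, isUnit_iff_ne_zero, not_not,
      ← neg_sub, Matrix.det_neg]
    simp [hD, Algebra.algebraMap_eq_smul_one]
  -- `dslope D z` is the entire function `D w / (w - z)`, with value `d` at `z`.
  have hq : ∀ w, w ≠ z → dslope D z w = (w - z)⁻¹ * D w := fun w hw => by
    rw [dslope_of_ne _ hw, slope_def_field, show D z = 0 from hdet, sub_zero, div_eq_inv_mul]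
  have hqz : dslope D z z = d := by rw [dslope_same, hd.deriv]
  have hq0 : ∀ w ∈ Metric.closedBall z δ, dslope D z w ≠ 0 := fun w hw => by
    by_cases h : w = z
    · rw [h, hqz]; exact hd0
    · rw [hq w h]
      refine mul_ne_zero (inv_ne_zero (sub_ne_zero.2 h)) fun h0 => ?_
      have := hδ.2 w ((hspec w).2 h0) h
      rw [Metric.mem_closedBall, dist_eq_norm] at hw
      linarith
  have hqd : ∀ w, DifferentiableAt ℂ (dslope D z) w := fun w => by
    by_cases h : w = z
    · rw [h]; exact (hDa z).dslope_self.differentiableAt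
    · exact (differentiableAt_dslope_of_ne h).2 (hDa w).differentiableAt
  ext a b
  set F : ℂ → ℂ := fun w =>
    -(A - w • (1 : Matrix (Fin N) (Fin N) ℂ)).adjugate a b / dslope D z w with hF
  have hFd : DifferentiableOn ℂ F (Metric.closedBall z δ) := fun w hw =>
    ((((hlin w).adjugate a b).differentiableAt.neg).div (hqd w)
      (hq0 w hw)).differentiableWithinAt
  have key := DiffContOnCl.circleIntegral_sub_inv_smul
    (hFd.diffContOnCl_ball subset_rfl) (Metric.mem_ball_self hδ.1)
  have hint : (∮ w in C(z, δ), ((w • (1 : Matrix (Fin N) (Fin N) ℂ) - A)⁻¹) a b) =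
      ∮ w in C(z, δ), (w - z)⁻¹ • F w := by
    refine circleIntegral.integral_congr hδ.1.le fun w hw => ?_
    have hwz : w ≠ z := by
      rintro rfl
      simp at hw
      exact hδ.1.ne hw
    have hwb := hq0 w (Metric.sphere_subset_closedBall hw)
    have hDw : D w ≠ 0 := fun h => hwb (by rw [hq w hwz, h, mul_zero])
    have hinv : (w • (1 : Matrix (Fin N) (Fin N) ℂ) - A)⁻¹ =
        -((D w)⁻¹ • (A - w • (1 : Matrix (Fin N) (Fin N) ℂ)).adjugate) := by
      refine Matrix.inv_eq_right_inv ?_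
      rw [← neg_sub A, neg_mul_neg, Matrix.mul_smul, Matrix.mul_adjugate, smul_smul]
      simp only [hD] at hDw ⊢
      rw [inv_mul_cancel₀ hDw, one_smul]
    simp only [hF, hinv, hq w hwz, Matrix.neg_apply, Matrix.smul_apply, smul_eq_mul]
    have := sub_ne_zero.2 hwz
    field_simp
  simp only [contourProjection, Matrix.of_apply]
  rw [hint, key]
  simp only [hF, hqz, Matrix.smul_apply, smul_eq_mul]
  have : (Real.pi : ℂ) ≠ 0 := by exact_mod_cast Real.pi_ne_zero
  field_simp [Complex.I_ne_zero]

/-- At an eigenvalue `0` of `K`, the matrix `-d⁻¹ • adj K` is idempotent, where `d` is the derivative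
of `det (K - w)` at `0` (if `d ≠ 0`). -/
theorem adjugate_mul_self_of_hasDerivAt {N : ℕ} {K : Matrix (Fin N) (Fin N) ℂ} {d : ℂ}
    (hdet : K.det = 0)
    (hd : HasDerivAt (fun w : ℂ => (K - w • (1 : Matrix (Fin N) (Fin N) ℂ)).det) d 0) :
    K.adjugate * K.adjugate = -d • K.adjugate := by
  have h1 : ∀ w : ℂ, (K - w • (1 : Matrix (Fin N) (Fin N) ℂ)).det • K.adjugate =
      -w • ((K - w • (1 : Matrix (Fin N) (Fin N) ℂ)).adjugate * K.adjugate) := fun w => by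
    have h2 : (K - w • (1 : Matrix (Fin N) (Fin N) ℂ)) * K.adjugate = -w • K.adjugate := by
      rw [sub_mul, Matrix.mul_adjugate, hdet]
      simp
    have h3 : (K - w • (1 : Matrix (Fin N) (Fin N) ℂ)).det • K.adjugate =
        (K - w • (1 : Matrix (Fin N) (Fin N) ℂ)).adjugate *
          ((K - w • (1 : Matrix (Fin N) (Fin N) ℂ)) * K.adjugate) := by
      rw [← mul_assoc, Matrix.adjugate_mul, Matrix.smul_mul, one_mul]
    rw [h3, h2, Matrix.mul_smul]
  -- Divide by `w` and let `w` tend to `0`.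
  have hlim1 : Tendsto (fun w : ℂ => -(K - w • (1 : Matrix (Fin N) (Fin N) ℂ)).adjugate *
      K.adjugate) (𝓝[≠] 0) (𝓝 (-K.adjugate * K.adjugate)) := by
    have hc : ContinuousAt (fun w : ℂ => -(K - w • (1 : Matrix (Fin N) (Fin N) ℂ)).adjugate *
        K.adjugate) 0 := by
      refine ContinuousAt.mul (ContinuousAt.neg ?_) continuousAt_const
      exact ((EntrywiseAnalyticAt.const K).sub
        (.smul (f := fun w => w) (by fun_prop) (.const 1))).adjugate.continuousAt
    have := hc.tendsto
    simp only [zero_smul, sub_zero] at this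
    exact this.mono_left nhdsWithin_le_nhds
  have hlim2 : Tendsto (fun w : ℂ => -(K - w • (1 : Matrix (Fin N) (Fin N) ℂ)).adjugate *
      K.adjugate) (𝓝[≠] 0) (𝓝 (d • K.adjugate)) := by
    have hs := (hasDerivAt_iff_tendsto_slope.1 hd).smul_const K.adjugate
    refine hs.congr' ?_
    filter_upwards [self_mem_nhdsWithin] with w hw
    have hw : w ≠ 0 := hw
    rw [slope_def_field]
    simp only [zero_smul, sub_zero, hdet]
    rw [div_eq_inv_mul, mul_smul, h1 w, smul_smul, mul_neg, inv_mul_cancel₀ hw]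
    simp
  have := tendsto_nhds_unique hlim1 hlim2
  rw [neg_mul] at this
  rw [neg_smul, ← this, neg_neg]

/-! ### Second-order expansions -/

theorem AnalyticAt.exists_second_order {f : ℂ → ℂ} (hf : AnalyticAt ℂ f 0) :
    ∃ r : ℂ → ℂ, AnalyticAt ℂ r 0 ∧ r 0 = iteratedDeriv 2 f 0 / 2 ∧
      ∀ t, f t = f 0 + t * deriv f 0 + t ^ 2 * r t := by
  have h1 := hf.dslope_self
  have e : ∀ (g : ℂ → ℂ) t, g t = g 0 + t * dslope g 0 t := fun g t => by
    have := sub_smul_dslope g 0 t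
    simp only [sub_zero, smul_eq_mul] at this
    rw [this]; ring
  refine ⟨dslope (dslope f 0) 0, h1.dslope_self, ?_, fun t => ?_⟩
  · have h2 := (hf.hasFPowerSeriesAt.has_fpower_series_iterate_dslope_fslope 2).coeff_zero 1
    simp only [Function.iterate_succ, Function.iterate_zero, Function.comp, id,
      Function.swap] at h2
    rw [← h2]
    have h3 := FormalMultilinearSeries.coeff_iterate_fslope
      (p := FormalMultilinearSeries.ofScalars ℂ fun n => iteratedDeriv n f 0 / n.factorial) 2 0
    refine h3.trans ?_
    rw [FormalMultilinearSeries.coeff_ofScalars]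
    simp
  · rw [e f t, e (dslope f 0) t, dslope_same f]
    ring

/-- Comparison of coefficients up to order two in a product that vanishes off `0`. -/
theorem coeffs_of_mul_eq_zero {E : Type*} [Ring E] [Algebra ℂ E] [TopologicalSpace E] [T2Space E]
    [IsTopologicalRing E] [ContinuousSMul ℂ E] {a b : ℂ → E} {a₀ a₁ b₀ b₁ : E} {a₂ b₂ : ℂ → E}
    (ha : ∀ t, a t = a₀ + t • a₁ + t ^ 2 • a₂ t) (hb : ∀ t, b t = b₀ + t • b₁ + t ^ 2 • b₂ t)
    (ha₂ : ContinuousAt a₂ 0) (hb₂ : ContinuousAt b₂ 0)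
    (hab : ∀ᶠ t in 𝓝[≠] (0 : ℂ), a t * b t = 0) :
    a₀ * b₀ = 0 ∧ a₀ * b₁ + a₁ * b₀ = 0 ∧ a₀ * b₂ 0 + a₁ * b₁ + a₂ 0 * b₀ = 0 := by
  have lim : ∀ {F : ℂ → E} {y : E}, ContinuousAt F 0 → F 0 = y →
      (∀ᶠ t in 𝓝[≠] (0 : ℂ), F t = 0) → y = 0 := fun {F y} hF h0 h => by
    rw [← h0]
    exact tendsto_nhds_unique (hF.tendsto.mono_left nhdsWithin_le_nhds)
      (tendsto_const_nhds.congr' (h.mono fun t ht => ht.symm))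
  have ha' : ContinuousAt a 0 := by
    rw [show a = _ from funext ha]; fun_prop
  have hb' : ContinuousAt b 0 := by
    rw [show b = _ from funext hb]; fun_prop
  have h0 : a₀ * b₀ = 0 := lim (ha'.mul hb') (by simp [ha, hb]) hab
  have h1 : a₀ * b₁ + a₁ * b₀ = 0 := by
    refine lim (F := fun t => a₀ * (b₁ + t • b₂ t) + (a₁ + t • a₂ t) * b t)
      (by fun_prop) (by simp [hb]) ?_
    filter_upwards [hab, self_mem_nhdsWithin] with t ht ht0
    refine (smul_eq_zero_iff_right (r := t) ht0).1 ?_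
    rw [← sub_eq_zero.2 (ht.trans h0.symm), ha t, hb t]
    simp only [mul_add, add_mul, smul_mul_assoc, mul_smul_comm]
    module
  refine ⟨h0, h1, ?_⟩
  refine lim (F := fun t => a₀ * b₂ t + a₁ * (b₁ + t • b₂ t) + a₂ t * b t)
    (by fun_prop) (by simp [hb]) ?_
  filter_upwards [hab, self_mem_nhdsWithin] with t ht ht0
  refine (smul_eq_zero_iff_right (r := t ^ 2) (pow_ne_zero 2 ht0)).1 ?_
  have : t • (a₀ * b₁ + a₁ * b₀) = 0 := by rw [h1, smul_zero]
  rw [← sub_eq_zero.2 (ht.trans h0.symm), ← sub_zero (_ - _), ← this, ha t, hb t]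
  simp only [mul_add, add_mul, smul_mul_assoc, mul_smul_comm]
  module

/-! ### Spectral decomposition of a normal matrix -/

section Normal

variable {N : ℕ} {A : Matrix (Fin N) (Fin N) ℂ}

theorem isStarNormal_toEuclideanCLM_sub (hA : IsStarNormal A) (μ : ℂ) :
    IsStarNormal (Matrix.toEuclideanCLM (n := Fin N) (𝕜 := ℂ) (A - μ • 1)) := by
  have h1 : IsStarNormal (A - μ • (1 : Matrix (Fin N) (Fin N) ℂ)) := by
    have := hA.star_comm_self
    refine ⟨?_⟩
    rw [star_sub, star_smul, star_one]
    exact ((this.sub_right ((Commute.one_right _).smul_right _))).sub_left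
      (((Commute.one_left _).smul_left _))
  exact h1.map _

theorem mem_eigenspace_toEuclideanLin_iff {μ : ℂ} {v : EuclideanSpace ℂ (Fin N)} :
    v ∈ Module.End.eigenspace (Matrix.toEuclideanLin A) μ ↔
      Matrix.toEuclideanCLM (n := Fin N) (𝕜 := ℂ) (A - μ • 1) v = 0 := by
  rw [Module.End.mem_eigenspace_iff, ← sub_eq_zero]
  have : Matrix.toEuclideanCLM (n := Fin N) (𝕜 := ℂ) (A - μ • 1) v =
      Matrix.toEuclideanLin A v - μ • v := by
    rw [map_sub, map_smul, map_one]
    rfl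
  rw [this]

theorem star_apply_of_mem_eigenspace (hA : IsStarNormal A) {μ : ℂ} {v : EuclideanSpace ℂ (Fin N)}
    (hv : v ∈ Module.End.eigenspace (Matrix.toEuclideanLin A) μ) :
    ContinuousLinearMap.adjoint (Matrix.toEuclideanCLM (n := Fin N) (𝕜 := ℂ) A) v =
      (starRingEnd ℂ μ) • v := by
  have h := (ContinuousLinearMap.IsStarNormal.adjoint_apply_eq_zero_iff
    (isStarNormal_toEuclideanCLM_sub hA μ) v).2 (mem_eigenspace_toEuclideanLin_iff.1 hv)
  rw [map_sub, map_smul, map_one, map_sub, map_smulₛₗ] at h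
  rw [← sub_eq_zero, ← h]
  simp [← ContinuousLinearMap.star_eq_adjoint]

theorem iSup_eigenspace_toEuclideanLin (hA : IsStarNormal A) :
    ⨆ μ, Module.End.eigenspace (Matrix.toEuclideanLin A) μ = ⊤ := by
  rw [eq_top_iff, ← Module.End.iSup_maxGenEigenspace_eq_top (Matrix.toEuclideanLin A)]
  refine iSup_mono fun μ v hv => ?_
  rw [Module.End.mem_maxGenEigenspace] at hv
  obtain ⟨k, hk⟩ := hv
  set T := Matrix.toEuclideanLin A - μ • (1 : Module.End ℂ (EuclideanSpace ℂ (Fin N))) with hT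
  -- For normal `T` the kernel is orthogonal to the range, so `T²` and `T` have the same kernel.
  have hsq : ∀ w, T (T w) = 0 → T w = 0 := fun w hw => by
    have hN := isStarNormal_toEuclideanCLM_sub hA μ
    have hTe : ∀ u, T u = Matrix.toEuclideanCLM (n := Fin N) (𝕜 := ℂ) (A - μ • 1) u := fun u => by
      rw [map_sub, map_smul, map_one]; rfl
    have h1 : T w ∈ (Matrix.toEuclideanCLM (n := Fin N) (𝕜 := ℂ) (A - μ • 1)).rangeᗮ := by
      rw [ContinuousLinearMap.IsStarNormal.orthogonal_range hN]
      exact (hTe _).symm.trans hw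
    have h2 : T w ∈ (Matrix.toEuclideanCLM (n := Fin N) (𝕜 := ℂ) (A - μ • 1)).range :=
      ⟨w, (hTe w).symm⟩
    exact inner_self_eq_zero.1 (h1 _ h2)
  rw [Module.End.mem_eigenspace_iff, ← sub_eq_zero]
  change T v = 0
  induction k with
  | zero => simp at hk; simp [hk]
  | succ k ih =>
    rcases k with _ | k
    · simpa using hk
    · refine ih ?_
      rw [pow_succ', Module.End.mul_apply] at hk ⊢
      rw [pow_succ', Module.End.mul_apply] at hk
      exact hsq _ hk

theorem orthogonalFamily_eigenspace_toEuclideanLin (hA : IsStarNormal A) :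
    OrthogonalFamily ℂ (fun μ => Module.End.eigenspace (Matrix.toEuclideanLin A) μ)
      fun μ => (Module.End.eigenspace (Matrix.toEuclideanLin A) μ).subtypeₗᵢ := by
  rintro μ ν hne ⟨v, hv⟩ ⟨w, hw⟩
  change inner ℂ v w = 0
  have h1 := ContinuousLinearMap.adjoint_inner_left
    (Matrix.toEuclideanCLM (n := Fin N) (𝕜 := ℂ) A) w v
  have h2 : Matrix.toEuclideanCLM (n := Fin N) (𝕜 := ℂ) A w = ν • w :=
    Module.End.mem_eigenspace_iff.1 hw
  rw [star_apply_of_mem_eigenspace hA hv, h2, inner_smul_left, inner_smul_right,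
    Complex.conj_conj] at h1
  have h3 : (μ - ν) * inner ℂ v w = 0 := by rw [sub_mul, h1, sub_self]
  exact (mul_eq_zero.1 h3).resolve_left (sub_ne_zero.2 hne)

theorem toEuclideanCLM_eigenProjection (μ : ℂ) :
    Matrix.toEuclideanCLM (n := Fin N) (𝕜 := ℂ) (eigenProjection A μ) =
      (Module.End.eigenspace (Matrix.toEuclideanLin A) μ).starProjection := by
  simp [eigenProjection]

theorem mul_eigenProjection (μ : ℂ) :
    A * eigenProjection A μ = μ • eigenProjection A μ := by
  apply EquivLike.injective (Matrix.toEuclideanCLM (n := Fin N) (𝕜 := ℂ))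
  rw [map_mul, map_smul, toEuclideanCLM_eigenProjection]
  ext1 v
  exact Module.End.mem_eigenspace_iff.1
    ((Module.End.eigenspace (Matrix.toEuclideanLin A) μ).starProjection_apply_mem v)

theorem eigenProjection_mul (hA : IsStarNormal A) (μ : ℂ) :
    eigenProjection A μ * A = μ • eigenProjection A μ := by
  apply EquivLike.injective (Matrix.toEuclideanCLM (n := Fin N) (𝕜 := ℂ))
  rw [map_mul, map_smul, toEuclideanCLM_eigenProjection]
  apply star_injective
  rw [star_mul, star_smul, isSelfAdjoint_starProjection _ |>.star_eq]
  ext1 v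
  exact star_apply_of_mem_eigenspace hA (Submodule.starProjection_apply_mem _ v)

theorem sum_eigenProjection (hA : IsStarNormal A) :
    ∑ μ ∈ (Matrix.finite_spectrum A).toFinset, eigenProjection A μ = 1 := by
  set s := (Matrix.finite_spectrum A).toFinset
  apply EquivLike.injective (Matrix.toEuclideanCLM (n := Fin N) (𝕜 := ℂ))
  rw [map_sum, map_one]
  ext1 v
  simp only [toEuclideanCLM_eigenProjection, sum_apply]
  have hfam := (orthogonalFamily_eigenspace_toEuclideanLin hA).comp
    (γ := s) Subtype.val_injective
  have htop : v ∈ ⨆ μ : s, Module.End.eigenspace (Matrix.toEuclideanLin A) (μ : ℂ) := by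
    have : v ∈ ⨆ μ, Module.End.eigenspace (Matrix.toEuclideanLin A) μ := by
      rw [iSup_eigenspace_toEuclideanLin hA]; trivial
    refine iSup_le (a := ⨆ μ : s, Module.End.eigenspace (Matrix.toEuclideanLin A) (μ : ℂ))
      (fun μ => ?_) this
    by_cases hμ : μ ∈ s
    · exact le_iSup (fun μ : s => Module.End.eigenspace (Matrix.toEuclideanLin A) (μ : ℂ)) ⟨μ, hμ⟩
    · have hb : Module.End.eigenspace (Matrix.toEuclideanLin A) μ = ⊥ := by
        by_contra hne
        refine hμ ?_
        rw [Set.Finite.mem_toFinset, ← Matrix.spectrum_toLpLin 2]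
        exact Module.End.hasEigenvalue_iff_mem_spectrum.1 hne
      rw [hb]
      exact bot_le
  have := hfam.sum_projection_of_mem_iSup v htop
  rw [Finset.sum_coe_sort s (fun μ =>
    (Module.End.eigenspace (Matrix.toEuclideanLin A) μ).starProjection v)] at this
  simpa using this

theorem exists_diagonalization (hA : IsStarNormal A) :
    ∃ (U V : Matrix (Fin N) (Fin N) ℂ) (d : Fin N → ℂ), V * U = 1 ∧
      A = U * Matrix.diagonal d * V := by
  set S : Set (EuclideanSpace ℂ (Fin N)) :=
    {v | ∃ μ : ℂ, v ∈ Module.End.eigenspace (Matrix.toEuclideanLin A) μ} with hS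
  have hspan : ⊤ ≤ Submodule.span ℂ S := by
    rw [← iSup_eigenspace_toEuclideanLin hA]
    exact iSup_le fun μ v hv => Submodule.subset_span ⟨μ, hv⟩
  let b₀ := Module.Basis.ofSpan hspan
  have : Fintype _ := FiniteDimensional.fintypeBasisIndex b₀
  let e : _ ≃ Fin N := Fintype.equivOfCardEq (by
    rw [← Module.finrank_eq_card_basis b₀]; simp)
  let b := b₀.reindex e
  have hb : ∀ i, ∃ μ : ℂ, b i ∈ Module.End.eigenspace (Matrix.toEuclideanLin A) μ := fun i => by
    have : b i ∈ S := by
      simp only [b, Module.Basis.reindex_apply]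
      exact Module.Basis.ofSpan_subset hspan ⟨_, rfl⟩
    exact this
  choose d hd using hb
  let U : Matrix (Fin N) (Fin N) ℂ := (EuclideanSpace.basisFun (Fin N) ℂ).toBasis.toMatrix b
  let V : Matrix (Fin N) (Fin N) ℂ := b.toMatrix (EuclideanSpace.basisFun (Fin N) ℂ).toBasis
  have hVU : V * U = 1 := Module.Basis.toMatrix_mul_toMatrix_flip _ _
  have hAU : A * U = U * Matrix.diagonal d := by
    ext i j
    have h1 := congrArg (fun v : EuclideanSpace ℂ (Fin N) => v i)
      (Module.End.mem_eigenspace_iff.1 (hd j))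
    rw [Matrix.mul_diagonal]
    simpa [Matrix.toLpLin_apply, Matrix.mulVec, dotProduct, Matrix.mul_apply, U,
      Module.Basis.toMatrix_apply, mul_comm] using h1
  refine ⟨U, V, d, hVU, ?_⟩
  rw [← hAU, mul_assoc, mul_eq_one_comm.1 hVU, mul_one]

/-- `-T_lam` is a generalized inverse of `A - lam`. -/
theorem sub_mul_reducedResolvent_mul_sub (hA : IsStarNormal A) (lam : ℂ) :
    (A - lam • 1) * reducedResolvent A lam * (A - lam • 1) = -(A - lam • 1) := by
  set σ := (Matrix.finite_spectrum A).toFinset with hσ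
  have h1 : reducedResolvent A lam * (A - lam • 1) =
      -∑ μ ∈ σ.erase lam, eigenProjection A μ := by
    rw [reducedResolvent, Finset.sum_mul, ← Finset.sum_neg_distrib]
    refine Finset.sum_congr rfl fun μ hμ => ?_
    have hne := sub_ne_zero.2 (Finset.ne_of_mem_erase hμ).symm
    rw [Matrix.smul_mul, mul_sub, eigenProjection_mul hA, Matrix.mul_smul, mul_one, ← sub_smul,
      smul_smul, ← neg_sub lam μ, mul_neg, inv_mul_cancel₀ hne, neg_one_smul]
  have h2 : (A - lam • 1) * eigenProjection A lam = 0 := by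
    rw [sub_mul, mul_eigenProjection, Matrix.smul_mul, one_mul, sub_self]
  rw [mul_assoc, h1, mul_neg, Finset.mul_sum, Finset.sum_erase σ h2, ← Finset.mul_sum,
    sum_eigenProjection hA, mul_one]

theorem reducedResolvent_mul_eq_zero (hA : IsStarNormal A) {lam : ℂ}
    {P : Matrix (Fin N) (Fin N) ℂ} (hP : A * P = lam • P) : reducedResolvent A lam * P = 0 := by
  rw [reducedResolvent, Finset.sum_mul]
  refine Finset.sum_eq_zero fun μ hμ => ?_
  have h : (lam - μ) • (eigenProjection A μ * P) = 0 := by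
    rw [sub_smul, ← Matrix.smul_mul μ, ← eigenProjection_mul hA, mul_assoc, hP, Matrix.mul_smul,
      sub_self]
  rw [Matrix.smul_mul, (smul_eq_zero_iff_right (sub_ne_zero.2 (Finset.ne_of_mem_erase hμ).symm)).1 h,
    smul_zero]

theorem mul_reducedResolvent_eq_zero {lam : ℂ} {P : Matrix (Fin N) (Fin N) ℂ}
    (hP : P * A = lam • P) : P * reducedResolvent A lam = 0 := by
  rw [reducedResolvent, Finset.mul_sum]
  refine Finset.sum_eq_zero fun μ hμ => ?_
  have h : (lam - μ) • (P * eigenProjection A μ) = 0 := by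
    rw [sub_smul, ← Matrix.mul_smul P μ, ← mul_eigenProjection, ← mul_assoc, hP, Matrix.smul_mul,
      sub_self]
  rw [Matrix.mul_smul, (smul_eq_zero_iff_right (sub_ne_zero.2 (Finset.ne_of_mem_erase hμ).symm)).1 h,
    smul_zero]

end Normal

/-! ### The limit projection and its moments -/

/-- The projections at the eigenvalue `z` of `A t` extend analytically to `t = 0`, provided that the
derivative `g t` of `det (A t - w)` at `w = z` vanishes at `t = 0` to order at most
`dim ker (A 0 - z) - 1`. -/
theorem exists_analytic_limitProjection {N : ℕ} {A : ℂ → Matrix (Fin N) (Fin N) ℂ} {z : ℂ}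
    (hA : EntrywiseAnalyticAt A 0) {U V : Matrix (Fin N) (Fin N) ℂ} (hVU : V * U = 1)
    {d : Fin N → ℂ} (h0 : A 0 - z • 1 = U * Matrix.diagonal d * V) {n : ℕ}
    (hn : n + 1 ≤ (Finset.univ.filter fun i => d i = 0).card)
    {g : ℂ → ℂ} (hga : AnalyticAt ℂ g 0) (hgn : analyticOrderAt g 0 = n)
    (hdet : ∀ᶠ t in 𝓝 (0 : ℂ), (A t - z • 1).det = 0)
    (hg : ∀ᶠ t in 𝓝 (0 : ℂ), HasDerivAt (fun w : ℂ => (A t - w • 1).det) (g t) z) :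
    ∃ P : ℂ → Matrix (Fin N) (Fin N) ℂ, EntrywiseAnalyticAt P 0 ∧ IsLimitProjection A z (P 0) ∧
      ∀ᶠ t in 𝓝[≠] (0 : ℂ), (A t - z • 1) * P t = 0 ∧ P t * (A t - z • 1) = 0 ∧
        P t * P t = P t := by
  obtain ⟨C, hC, hadj⟩ := exists_adjugate_eq_pow_smul (K := fun t => A t - z • 1)
    (hA.sub (.const (z • 1))) hVU h0 hn
  obtain ⟨G, hG, hG0, hgG⟩ := (hga.analyticOrderAt_eq_natCast).1 hgn
  have hne : ∀ᶠ t in 𝓝[≠] (0 : ℂ), g t ≠ 0 ∧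
      -(g t)⁻¹ • (A t - z • 1).adjugate = -(G t)⁻¹ • C t := by
    filter_upwards [self_mem_nhdsWithin, nhdsWithin_le_nhds hgG,
      nhdsWithin_le_nhds (hG.continuousAt.eventually_ne hG0)] with t ht h1 h2
    have htn : t ^ n ≠ 0 := pow_ne_zero n ht
    rw [sub_zero, smul_eq_mul] at h1
    refine ⟨h1 ▸ mul_ne_zero htn h2, ?_⟩
    have h3 : (A t - z • 1).adjugate = t ^ n • C t := hadj t
    rw [h3, h1, smul_smul]
    congr 1
    field_simp
  have hPa : EntrywiseAnalyticAt (fun t => -(G t)⁻¹ • C t) 0 := .smul (hG.inv hG0).neg hC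
  refine ⟨fun t => -(G t)⁻¹ • C t, hPa, fun δ hδ => ?_, ?_⟩
  · refine (hPa.continuousAt.tendsto.mono_left nhdsWithin_le_nhds).congr' ?_
    filter_upwards [hne, nhdsWithin_le_nhds hdet, nhdsWithin_le_nhds hg, hδ] with t h1 h2 h3 h4
    rw [contourProjection_eq h2 h3 h1.1 h4, h1.2]
  · filter_upwards [hne, nhdsWithin_le_nhds hdet, nhdsWithin_le_nhds hg] with t h1 h2 h3
    rw [← h1.2]
    have hd : HasDerivAt (fun w : ℂ => (A t - z • 1 - w • 1).det) (g t) 0 := by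
      have h4 := HasDerivAt.comp_const_add z 0 (by simpa using h3)
      simpa only [sub_sub, add_smul] using h4
    refine ⟨?_, ?_, ?_⟩
    · rw [Matrix.mul_smul, Matrix.mul_adjugate, h2, zero_smul, smul_zero]
    · rw [Matrix.smul_mul, Matrix.adjugate_mul, h2, zero_smul, smul_zero]
    · rw [Matrix.smul_mul, Matrix.mul_smul, adjugate_mul_self_of_hasDerivAt h2 hd, smul_smul,
        smul_smul]
      have := h1.1
      congr 1
      field_simp

theorem EntrywiseAnalyticAt.exists_second_order {N : ℕ} {P : ℂ → Matrix (Fin N) (Fin N) ℂ}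
    (hP : EntrywiseAnalyticAt P 0) :
    ∃ (P₁ : Matrix (Fin N) (Fin N) ℂ) (P₂ : ℂ → Matrix (Fin N) (Fin N) ℂ),
      ContinuousAt P₂ 0 ∧ ∀ t, P t = P 0 + t • P₁ + t ^ 2 • P₂ t := by
  choose r hr _ hPr using fun a b => (hP a b).exists_second_order
  refine ⟨Matrix.of fun a b => deriv (fun t => P t a b) 0, fun t => Matrix.of fun a b => r a b t,
    EntrywiseAnalyticAt.continuousAt hr, fun t => ?_⟩
  ext a b
  simpa using hPr a b t

/-- First- and second-order perturbation identities for an analytic family of projections `P` with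
`K P = P K = 0`, in terms of a generalized inverse `S` of `K 0`. The first-order coefficients of
`K P = 0` and `P K = 0` express `K₁ P(0)` and `P(0) K₁` through `P'(0)`, so the latter drops out of
the second-order coefficient. -/
theorem limitProjection_identities {N : ℕ} {K P : ℂ → Matrix (Fin N) (Fin N) ℂ}
    {K₀ K₁ S : Matrix (Fin N) (Fin N) ℂ} {K₂ : ℂ → Matrix (Fin N) (Fin N) ℂ}
    (hK : ∀ t, K t = K₀ + t • K₁ + t ^ 2 • K₂ t) (hK₂ : ContinuousAt K₂ 0)
    (hP : EntrywiseAnalyticAt P 0)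
    (h : ∀ᶠ t in 𝓝[≠] (0 : ℂ), K t * P t = 0 ∧ P t * K t = 0 ∧ P t * P t = P t)
    (hS : K₀ * S * K₀ = K₀) :
    P 0 * P 0 = P 0 ∧ K₀ * P 0 = 0 ∧ P 0 * K₀ = 0 ∧ P 0 * K₁ * P 0 = 0 ∧
      P 0 * K₁ * S * K₁ * P 0 = P 0 * K₂ 0 * P 0 := by
  obtain ⟨P₁, P₂, hP₂, hPt⟩ := hP.exists_second_order
  obtain ⟨h1, h2, h3⟩ := coeffs_of_mul_eq_zero hK hPt hK₂ hP₂ (h.mono fun t ht => ht.1)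
  obtain ⟨h4, h5, -⟩ := coeffs_of_mul_eq_zero hPt hK hP₂ hK₂ (h.mono fun t ht => ht.2.1)
  have hPP : P 0 * P 0 = P 0 := by
    have hc : Tendsto P (𝓝[≠] 0) (𝓝 (P 0)) := hP.continuousAt.tendsto.mono_left nhdsWithin_le_nhds
    exact tendsto_nhds_unique (hc.mul hc) (hc.congr' (h.mono fun t ht => ht.2.2.symm))
  have h6 : P 0 * K₁ = -(P₁ * K₀) := eq_neg_of_add_eq_zero_left h5
  have h7 : K₁ * P 0 = -(K₀ * P₁) := eq_neg_of_add_eq_zero_right h2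
  refine ⟨hPP, h1, h4, ?_, ?_⟩
  · rw [h6, neg_mul, mul_assoc, h1, mul_zero, neg_zero]
  · have h8 : P 0 * K₁ * P₁ + P 0 * K₂ 0 * P 0 = 0 := by
      have := congrArg (P 0 * ·) h3
      simpa only [mul_add, ← mul_assoc, h4, zero_mul, zero_add, mul_zero] using this
    calc P 0 * K₁ * S * K₁ * P 0 = (P 0 * K₁) * S * (K₁ * P 0) := by simp only [mul_assoc]
      _ = P₁ * (K₀ * S * K₀) * P₁ := by rw [h6, h7]; simp only [neg_mul, mul_neg, neg_neg, mul_assoc]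
      _ = -(P 0 * K₁ * P₁) := by rw [hS, h6, neg_mul, neg_neg]
      _ = _ := (eq_neg_of_add_eq_zero_right h8).symm

/-! ### Polynomials along analytic curves -/

open MvPolynomial

theorem MvPolynomial.hasDerivAt_eval {σ : Type*} [Fintype σ] (p : MvPolynomial σ ℂ)
    {γ : ℂ → σ → ℂ} {γ' : σ → ℂ} {t : ℂ} (hγ : ∀ i, HasDerivAt (fun t => γ t i) (γ' i) t) :
    HasDerivAt (fun t => eval (γ t) p) (∑ i, γ' i * eval (γ t) (pderiv i p)) t := by
  classical
  induction p using MvPolynomial.induction_on with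
  | C a => simpa using hasDerivAt_const t a
  | add p q hp hq =>
    simpa only [map_add, mul_add, Finset.sum_add_distrib] using hp.fun_add hq
  | mul_X p i hp =>
    convert! hp.mul (hγ i) using 1
    · funext s; simp
    · simp only [pderiv_mul, pderiv_X, map_add, map_mul, eval_X, mul_add, Finset.sum_add_distrib,
        Finset.sum_mul]
      congr 1
      · exact Finset.sum_congr rfl fun k _ => by ring
      · rw [Finset.sum_eq_single i]
        · simp [mul_comm]
        · intro b _ hb; simp [hb.symm]
        · simp

theorem MvPolynomial.analyticAt_eval {σ : Type*} (p : MvPolynomial σ ℂ)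
    {E : Type*} [NormedAddCommGroup E] [NormedSpace ℂ E]
    {γ : E → σ → ℂ} {t : E} (hγ : ∀ i, AnalyticAt ℂ (fun t => γ t i) t) :
    AnalyticAt ℂ (fun t => eval (γ t) p) t := by
  exact AnalyticAt.aeval_mvPolynomial hγ p

theorem analyticOrderAt_fun_prod {ι : Type*} (S : Finset ι) {f : ι → ℂ → ℂ} {z : ℂ}
    (hf : ∀ i ∈ S, AnalyticAt ℂ (f i) z) :
    analyticOrderAt (fun t => ∏ i ∈ S, f i t) z = ∑ i ∈ S, analyticOrderAt (f i) z := by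
  classical
  induction S using Finset.induction_on with
  | empty =>
    simpa using (analyticAt_const (v := (1 : ℂ)) (x := z)).analyticOrderAt_eq_zero.2 one_ne_zero
  | insert i S hi ih =>
    have hS : ∀ i ∈ S, AnalyticAt ℂ (f i) z := fun k hk => hf k (Finset.mem_insert_of_mem hk)
    rw [Finset.sum_insert hi, ← ih hS, ← analyticOrderAt_mul (hf i (Finset.mem_insert_self _ _))
      (Finset.analyticAt_fun_prod S hS)]
    congr 1
    funext t
    simp [Finset.prod_insert hi]

theorem analyticOrderAt_fun_prod_eq_card {ι : Type*} (S : Finset ι) {f : ι → ℂ → ℂ} {z : ℂ}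
    (hf : ∀ i ∈ S, AnalyticAt ℂ (f i) z) (hd : ∀ i ∈ S, f i z = 0 → deriv (f i) z ≠ 0) :
    analyticOrderAt (fun t => ∏ i ∈ S, f i t) z = (S.filter fun i => f i z = 0).card := by
  rw [analyticOrderAt_fun_prod S hf, Finset.card_filter]
  push_cast
  refine Finset.sum_congr rfl fun i hi => ?_
  by_cases h : f i z = 0
  · simpa [h] using (hf i hi).analyticOrderAt_eq_one_of_zero_deriv_ne_zero h (hd i hi h)
  · simpa [h] using (hf i hi).analyticOrderAt_eq_zero.2 h

/-- The order of vanishing of a product of polynomials along a curve that meets each of the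
components through its base point transversally. -/
theorem analyticOrderAt_eval_prod {s : ℕ} {R : Fin s → MvPolynomial (Fin 3) ℂ} {m : Fin s → ℕ}
    {u : MvPolynomial (Fin 3) ℂ} (hu : IsUnit u) (S : Finset (Fin s))
    {γ : ℂ → Fin 3 → ℂ} (hγ : ∀ i, AnalyticAt ℂ (fun t => γ t i) 0)
    (hm0 : ∀ i, 0 < m i) (hm : ∀ i ∈ S, eval (γ 0) (R i) = 0 → m i = 1)
    (hd : ∀ i ∈ S, eval (γ 0) (R i) = 0 → deriv (fun t => eval (γ t) (R i)) 0 ≠ 0) :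
    analyticOrderAt (fun t => eval (γ t) (u * ∏ i ∈ S, R i ^ m i)) 0 =
      (S.filter fun i => eval (γ 0) (R i) = 0).card := by
  have h1 : (fun t => eval (γ t) (u * ∏ i ∈ S, R i ^ m i)) =
      (fun t => eval (γ t) u) * fun t => ∏ i ∈ S, eval (γ t) (R i ^ m i) := by
    funext t
    simp [map_prod]
  have hpow : ∀ i, (eval (γ 0) (R i ^ m i) = 0 ↔ eval (γ 0) (R i) = 0) := fun i => by
    rw [map_pow, pow_eq_zero_iff (hm0 i).ne']
  rw [h1, analyticOrderAt_mul (u.analyticAt_eval hγ)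
    (Finset.analyticAt_fun_prod S fun i _ => (R i ^ m i).analyticAt_eval hγ),
    ((u.analyticAt_eval hγ).analyticOrderAt_eq_zero).2 (hu.map (eval (γ 0))).ne_zero, zero_add,
    analyticOrderAt_fun_prod_eq_card S (fun i _ => (R i ^ m i).analyticAt_eval hγ)]
  · simp only [hpow]
  · intro i hi h0
    rw [hpow] at h0
    rw [hm i hi h0, pow_one]
    exact hd i hi h0

/-- The analytic implicit function theorem for one equation in `ℂ × ℂ`. -/
theorem exists_analytic_implicit {F : ℂ × ℂ → ℂ} {y₀ d : ℂ} (hF : AnalyticAt ℂ F (0, y₀))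
    (h0 : F (0, y₀) = 0) (hd : HasDerivAt (fun y => F (0, y)) d y₀) (hd0 : d ≠ 0) :
    ∃ x : ℂ → ℂ, AnalyticAt ℂ x 0 ∧ x 0 = y₀ ∧ ∀ᶠ t in 𝓝 (0 : ℂ), F (t, x t) = 0 := by
  have hc : ContDiffAt ℂ ⊤ F (0, y₀) := hF.contDiffAt
  have hinv : (fderiv ℂ F (0, y₀) ∘L .inr ℂ ℂ ℂ).IsInvertible := by
    have h1 : fderiv ℂ F (0, y₀) (0, 1) = d := by
      have hline : HasDerivAt (fun y : ℂ => ((0 : ℂ), y)) (0, 1) y₀ :=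
        (hasDerivAt_const y₀ (0 : ℂ)).prodMk (hasDerivAt_id y₀)
      exact (hF.differentiableAt.hasFDerivAt.comp_hasDerivAt y₀ hline).unique hd
    refine ⟨ContinuousLinearEquiv.unitsEquivAut ℂ (Units.mk0 d hd0), ?_⟩
    ext
    simp [h1]
  refine ⟨hc.implicitFunction (by simp) hinv, ?_, hc.implicitFunction_apply_self _ _, ?_⟩
  · exact (hc.contDiffAt_implicitFunction (by simp) hinv).analyticAt
  · simpa [h0] using hc.eventually_apply_implicitFunction (by simp) hinv

/-! ### The determinant of the pencil and its components -/

theorem eval_pencilDet {N : ℕ} (A₁ A₂ : Matrix (Fin N) (Fin N) ℂ) (v : Fin 3 → ℂ) :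
    eval v (pencilDet A₁ A₂) = (v 0 • A₁ + v 1 • A₂ - v 2 • (1 : Matrix (Fin N) (Fin N) ℂ)).det := by
  rw [pencilDet, RingHom.map_det]
  congr 1
  ext a b
  by_cases h : a = b <;> simp [h]

theorem isHomogeneous_pencilDet {N : ℕ} (A₁ A₂ : Matrix (Fin N) (Fin N) ℂ) :
    (pencilDet A₁ A₂).IsHomogeneous N := by
  rw [pencilDet, Matrix.det_apply]
  refine IsHomogeneous.sum _ _ _ fun σ _ => ?_
  have h : ∀ a b, (((X 0 : MvPolynomial (Fin 3) ℂ) • A₁.map C +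
      (X 1 : MvPolynomial (Fin 3) ℂ) • A₂.map C - (X 2 : MvPolynomial (Fin 3) ℂ) • 1 :
      Matrix (Fin N) (Fin N) (MvPolynomial (Fin 3) ℂ)) a b).IsHomogeneous 1 := fun a b => by
    have hX : ∀ (k : Fin 3) (c : ℂ), (X k * C c : MvPolynomial (Fin 3) ℂ).IsHomogeneous 1 :=
      fun k c => by rw [mul_comm]; exact isHomogeneous_C_mul_X c k
    refine ((hX 0 _).add (hX 1 _)).sub ?_
    have : (1 : Matrix (Fin N) (Fin N) (MvPolynomial (Fin 3) ℂ)) a b =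
        C (if a = b then 1 else 0) := by
      by_cases h : a = b <;> simp [Matrix.one_apply, h]
    rw [Matrix.smul_apply, this]
    exact hX 2 _
  have hp := IsHomogeneous.prod Finset.univ _ (fun _ => 1) fun i _ => h (σ i) i
  simp only [Finset.sum_const, Finset.card_univ, Fintype.card_fin, smul_eq_mul, mul_one] at hp
  rcases Int.units_eq_one_or (Equiv.Perm.sign σ) with h1 | h1 <;> rw [h1]
  · simpa using hp
  · simpa using hp.neg

theorem IsIrreducibleFactorization.exists_eq_unit_mul {f : MvPolynomial (Fin 3) ℂ} {s : ℕ}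
    {R : Fin s → MvPolynomial (Fin 3) ℂ} {m : Fin s → ℕ} (h : IsIrreducibleFactorization f R m) :
    ∃ u : MvPolynomial (Fin 3) ℂ, IsUnit u ∧ f = u * ∏ i, R i ^ m i := by
  obtain ⟨u, hu⟩ := h.associated_prod.symm
  exact ⟨u, u.isUnit, by rw [← hu, mul_comm]⟩

section

variable {s : ℕ} {R : Fin s → MvPolynomial (Fin 3) ℂ} {m : Fin s → ℕ} {u : MvPolynomial (Fin 3) ℂ}
  {γ : ℂ → Fin 3 → ℂ}

theorem eval_pderiv_factorization {j : Fin s} {v : Fin 3 → ℂ} (hj : eval v (R j) = 0)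
    (hmj : m j = 1) (k : Fin 3) :
    eval v (pderiv k (u * ∏ i, R i ^ m i)) =
      eval v (pderiv k (R j)) * eval v (u * ∏ i ∈ Finset.univ.erase j, R i ^ m i) := by
  have h : u * ∏ i, R i ^ m i = R j * (u * ∏ i ∈ Finset.univ.erase j, R i ^ m i) := by
    rw [← Finset.mul_prod_erase _ _ (Finset.mem_univ j), hmj, pow_one]
    ring
  rw [h, pderiv_mul]
  simp [hj]

/-- Along a branch `γ` of the component `R j`, which the other components through `γ 0` cross
transversally, a first partial derivative of the product vanishes to order one less than the number
of components through `γ 0`. -/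
theorem analyticOrderAt_eval_pderiv (hu : IsUnit u) (hγ : ∀ i, AnalyticAt ℂ (fun t => γ t i) 0)
    (hm0 : ∀ i, 0 < m i) (hm : ∀ i, eval (γ 0) (R i) = 0 → m i = 1) {j : Fin s}
    (hj : ∀ᶠ t in 𝓝 (0 : ℂ), eval (γ t) (R j) = 0)
    (hd : ∀ i, i ≠ j → eval (γ 0) (R i) = 0 → deriv (fun t => eval (γ t) (R i)) 0 ≠ 0)
    {k : Fin 3} (hk : eval (γ 0) (pderiv k (R j)) ≠ 0) :
    analyticOrderAt (fun t => eval (γ t) (pderiv k (u * ∏ i, R i ^ m i))) 0 =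
      ((Finset.univ.filter fun i => eval (γ 0) (R i) = 0).card - 1 : ℕ) := by
  have hj0 : eval (γ 0) (R j) = 0 := hj.self_of_nhds
  have h1 : (fun t => eval (γ t) (pderiv k (u * ∏ i, R i ^ m i))) =ᶠ[𝓝 0]
      (fun t => eval (γ t) (pderiv k (R j))) *
        fun t => eval (γ t) (u * ∏ i ∈ Finset.univ.erase j, R i ^ m i) :=
    hj.mono fun t ht => eval_pderiv_factorization ht (hm j hj0) k
  rw [analyticOrderAt_congr h1, analyticOrderAt_mul ((pderiv k (R j)).analyticAt_eval hγ)
    (MvPolynomial.analyticAt_eval _ hγ),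
    (((pderiv k (R j)).analyticAt_eval hγ).analyticOrderAt_eq_zero).2 hk, zero_add,
    analyticOrderAt_eval_prod hu _ hγ hm0 (fun i _ => hm i)
      (fun i hi => hd i (Finset.ne_of_mem_erase hi)), Finset.filter_erase,
    Finset.card_erase_of_mem (by simpa using hj0)]

/-- The number of components through `γ 0` is the dimension of the kernel of the pencil there: both
are the order of vanishing of the determinant along a curve `γ` transversal to these components, on
which the pencil is simultaneously diagonalizable. -/
theorem card_components_eq_card_kernel (hu : IsUnit u)
    (hγ : ∀ i, AnalyticAt ℂ (fun t => γ t i) 0)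
    (hm0 : ∀ i, 0 < m i) (hm : ∀ i, eval (γ 0) (R i) = 0 → m i = 1)
    (hd : ∀ i, eval (γ 0) (R i) = 0 → deriv (fun t => eval (γ t) (R i)) 0 ≠ 0)
    {N : ℕ} {U V : Matrix (Fin N) (Fin N) ℂ} (hVU : V * U = 1) {a b : Fin N → ℂ}
    (hab : ∀ i, a i = 0 → b i ≠ 0)
    (hdet : ∀ t, eval (γ t) (u * ∏ i, R i ^ m i) =
      (U * Matrix.diagonal (fun i => a i + t * b i) * V).det) :
    (Finset.univ.filter fun i => eval (γ 0) (R i) = 0).card =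
      (Finset.univ.filter fun i => a i = 0).card := by
  have h1 := analyticOrderAt_eval_prod hu Finset.univ hγ hm0 (fun i _ => hm i) (fun i _ => hd i)
  have h2 : ∀ t, eval (γ t) (u * ∏ i, R i ^ m i) = ∏ i, (a i + t * b i) := fun t => by
    rw [hdet, Matrix.det_mul, Matrix.det_mul, mul_right_comm, ← Matrix.det_mul,
      mul_eq_one_comm.1 hVU, Matrix.det_one, one_mul, Matrix.det_diagonal]
  have hder : ∀ i, HasDerivAt (fun t : ℂ => a i + t * b i) (b i) 0 := fun i => by
    simpa using ((hasDerivAt_id (0 : ℂ)).mul_const (b i)).const_add (a i)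
  simp only [h2] at h1
  rw [analyticOrderAt_fun_prod_eq_card _ (fun i _ => by fun_prop)] at h1
  · simpa using (Nat.cast_injective (R := ℕ∞) h1).symm
  · intro i _ hi
    rw [(hder i).deriv]
    exact hab i (by simpa using hi)

end

/-- Curves with non-proportional gradients are transversal: the tangent `(p, q)` of one of them is not
annihilated by the gradient `(a, b)` of the other. -/
theorem pairing_ne_zero_of_linearIndependent {a b c d p q : ℂ} (hpq : p ≠ 0 ∨ q ≠ 0)
    (h : LinearIndependent ℂ ![![a, b], ![c, d]]) (hcd : p * c + q * d = 0) :
    p * a + q * b ≠ 0 := by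
  intro hab
  have hdet : a * d - b * c = 0 := by
    rcases hpq with hp | hq
    · exact (mul_eq_zero.1 (show p * (a * d - b * c) = 0 by
        linear_combination d * hab - b * hcd)).resolve_left hp
    · exact (mul_eq_zero.1 (show q * (a * d - b * c) = 0 by
        linear_combination a * hcd - c * hab)).resolve_left hq
  have h1 := LinearIndependent.pair_iff.1 h d (-b) (by
    ext i
    fin_cases i
    · simp; linear_combination hdet
    · simp; ring)
  have h2 := LinearIndependent.pair_iff.1 h c (-a) (by
    ext i
    fin_cases i
    · simp; ring
    · simp; linear_combination -hdet)
  have h3 := LinearIndependent.pair_iff.1 h 0 1 (by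
    ext i
    fin_cases i <;> simp [h1.1, h2.1])
  exact one_ne_zero h3.2

/-! ### The two charts -/

section Components

variable {N : ℕ} {A₁ A₂ : Matrix (Fin N) (Fin N) ℂ} {s : ℕ} {R : Fin s → MvPolynomial (Fin 3) ℂ}
  {m : Fin s → ℕ} {lam : ℂ} {j : Fin s}

theorem exists_isBranch {p : MvPolynomial (Fin 3) ℂ} (hlam : lam ≠ 0)
    (h0 : eval (basePoint lam) p = 0) (hd : partialAt p lam 0 ≠ 0) :
    ∃ x : ℂ → ℂ, IsBranch p lam x := by
  have hb : basePoint lam = ![1 / lam, 0, 1] := if_neg hlam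
  rw [partialAt, hb] at hd
  rw [hb] at h0
  obtain ⟨x, h1, h2, h3⟩ := exists_analytic_implicit (F := fun q : ℂ × ℂ => eval ![q.2, q.1, 1] p)
    (y₀ := 1 / lam) (p.analyticAt_eval fun i => by fin_cases i <;>
      simp [analyticAt_const, analyticAt_fst, analyticAt_snd]) h0
    (by
      refine p.hasDerivAt_eval (γ := fun y => ![y, 0, 1]) (γ' := ![1, 0, 0]) fun i => ?_
      fin_cases i
      · exact hasDerivAt_id _
      · exact hasDerivAt_const _ _
      · exact hasDerivAt_const _ _)
    (by simpa [Fin.sum_univ_three] using hd)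
  exact ⟨x, h1, h2, h3⟩

theorem exists_isBranchAtZero {p : MvPolynomial (Fin 3) ℂ}
    (h0 : eval (basePoint 0) p = 0) (hd : partialAt p 0 2 ≠ 0) :
    ∃ x : ℂ → ℂ, IsBranchAtZero p x := by
  have hb : basePoint 0 = ![1, 0, 0] := if_pos rfl
  rw [partialAt, hb] at hd
  rw [hb] at h0
  obtain ⟨x, h1, h2, h3⟩ := exists_analytic_implicit (F := fun q : ℂ × ℂ => eval ![1, q.1, q.2] p)
    (y₀ := 0) (p.analyticAt_eval fun i => by fin_cases i <;>
      simp [analyticAt_const, analyticAt_fst, analyticAt_snd]) h0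
    (by
      refine p.hasDerivAt_eval (γ := fun y => ![1, 0, y]) (γ' := ![0, 0, 1]) fun i => ?_
      fin_cases i
      · exact hasDerivAt_const _ _
      · exact hasDerivAt_const _ _
      · exact hasDerivAt_id _)
    (by simpa [Fin.sum_univ_three] using hd)
  exact ⟨x, h1, h2, h3⟩

/-- Existence of the limit projection in the chart `x₃ = 1`, as the value at `0` of an analytic family
of spectral projections. -/
theorem exists_limitProjection_of_isBranch (hA₁ : IsStarNormal A₁)
    (hR : IsIrreducibleFactorization (pencilDet A₁ A₂) R m) (hlam : lam ≠ 0)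
    (hreg : RegularAt R lam) (hm : ∀ j ∈ componentsThrough R lam, m j = 1)
    (hj : j ∈ componentsThrough R lam) {x : ℂ → ℂ} (hx : IsBranch (R j) lam x) :
    ∃ P : ℂ → Matrix (Fin N) (Fin N) ℂ, EntrywiseAnalyticAt P 0 ∧
      IsLimitProjection (fun t => x t • A₁ + t • A₂) 1 (P 0) ∧
      ∀ᶠ t in 𝓝[≠] (0 : ℂ), (x t • A₁ + t • A₂ - (1 : ℂ) • 1) * P t = 0 ∧
        P t * (x t • A₁ + t • A₂ - (1 : ℂ) • 1) = 0 ∧ P t * P t = P t := by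
  obtain ⟨u, hu, hf⟩ := hR.exists_eq_unit_mul
  obtain ⟨U, V, d, hVU, hd⟩ := exists_diagonalization hA₁
  obtain ⟨hreg1, hreg2⟩ := hreg.1 hlam
  have hb : basePoint lam = ![1 / lam, 0, 1] := if_neg hlam
  have hxa := hx.analyticAt
  have hI : ∀ i, i ∈ componentsThrough R lam ↔ eval ![1 / lam, 0, 1] (R i) = 0 := fun i => by
    rw [componentsThrough, hb]; rfl
  set γ : ℂ → Fin 3 → ℂ := fun t => ![x t, t, 1] with hγdef
  have hγ0 : γ 0 = ![1 / lam, 0, 1] := by simp [hγdef, hx.map_zero]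
  have hγ : ∀ i, AnalyticAt ℂ (fun t => γ t i) 0 := fun i => by
    fin_cases i <;> simp [hγdef] <;> fun_prop
  have hγ' : ∀ t, AnalyticAt ℂ x t → ∀ (p : MvPolynomial (Fin 3) ℂ),
      HasDerivAt (fun t => eval (γ t) p)
        (deriv x t * eval (γ t) (pderiv 0 p) + eval (γ t) (pderiv 1 p)) t := fun t ht p => by
    have := p.hasDerivAt_eval (γ := γ) (γ' := ![deriv x t, 1, 0]) (t := t) fun i => by
      fin_cases i
      · exact ht.differentiableAt.hasDerivAt
      · exact hasDerivAt_id _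
      · exact hasDerivAt_const _ _
    simpa [Fin.sum_univ_three] using this
  -- The line `x₂ = 0`, on which the determinant is that of a diagonal matrix.
  set η : ℂ → Fin 3 → ℂ := fun t => ![1 / lam + t, 0, 1] with hηdef
  have hη0 : η 0 = ![1 / lam, 0, 1] := by simp [hηdef]
  have hη : ∀ i, AnalyticAt ℂ (fun t => η t i) 0 := fun i => by
    fin_cases i <;> simp [hηdef] <;> fun_prop
  have hη' : ∀ (p : MvPolynomial (Fin 3) ℂ),
      HasDerivAt (fun t => eval (η t) p) (eval (η 0) (pderiv 0 p)) 0 := fun p => by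
    have := p.hasDerivAt_eval (γ := η) (γ' := ![1, 0, 0]) (t := 0) fun i => by
      fin_cases i
      · exact (hasDerivAt_id (0 : ℂ)).const_add _
      · exact hasDerivAt_const _ _
      · exact hasDerivAt_const _ _
    simpa [Fin.sum_univ_three] using this
  have hcard := card_components_eq_card_kernel (R := R) (m := m) hu hη hR.mult_pos
    (fun i hi => hm i ((hI i).2 (hη0 ▸ hi)))
    (fun i hi => by
      rw [(hη' (R i)).deriv, hη0, ← hb]
      exact hreg1 i ((hI i).2 (hη0 ▸ hi)))
    hVU (a := fun i => 1 / lam * d i - 1) (b := d)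
    (fun i hi h => by simp [h] at hi)
    (fun t => by
      rw [← hf, eval_pencilDet]
      congr 1
      have h1 : Matrix.diagonal (fun i => 1 / lam * d i - 1 + t * d i) =
          (1 / lam + t) • Matrix.diagonal d - 1 := by
        ext a b
        by_cases hab : a = b
        · subst hab; simp; ring
        · simp [hab]
      rw [h1, mul_sub, sub_mul, mul_one, mul_eq_one_comm.1 hVU, Matrix.mul_smul, Matrix.smul_mul,
        ← hd]
      simp [hηdef])
  rw [hη0] at hcard
  set k := (Finset.univ.filter fun i => eval ![1 / lam, 0, 1] (R i) = 0).card with hk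
  have hkpos : 0 < k := Finset.card_pos.2 ⟨j, by simpa using (hI j).1 hj⟩
  have hjt : deriv x 0 * partialAt (R j) lam 0 + partialAt (R j) lam 1 = 0 := by
    have h1 := hγ' 0 hxa (R j)
    rw [hγ0, ← hb] at h1
    have h2 : (fun t => eval (γ t) (R j)) =ᶠ[𝓝 0] fun _ => 0 := hx.eval_eq_zero
    exact h1.unique ((hasDerivAt_const (0 : ℂ) (0 : ℂ)).congr_of_eventuallyEq h2)
  have hord := analyticOrderAt_eval_pderiv (R := R) (m := m) hu hγ hR.mult_pos
    (fun i hi => hm i ((hI i).2 (hγ0 ▸ hi))) (j := j) hx.eval_eq_zero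
    (fun i hij hi => by
      have hi' := (hI i).2 (hγ0 ▸ hi)
      rw [(hγ' 0 hxa (R i)).deriv, hγ0, ← hb]
      simpa [partialAt] using pairing_ne_zero_of_linearIndependent (q := 1) (.inr one_ne_zero)
        (hreg2 i hi' j hj hij) (by simpa using hjt))
    (k := 0) (by rw [hγ0, ← hb]; exact hreg1 j hj)
  rw [hγ0, ← hk, ← hf] at hord
  -- `∂f/∂x₁` and `∂f/∂x₃` are proportional along the branch, by Euler's identity and `f ∘ γ = 0`.
  have hfγ : ∀ᶠ t in 𝓝 (0 : ℂ), eval (γ t) (pencilDet A₁ A₂) = 0 := by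
    filter_upwards [hx.eval_eq_zero] with t ht
    rw [hf, map_mul, map_prod, Finset.prod_eq_zero (Finset.mem_univ j), mul_zero]
    rw [map_pow, hm j hj, pow_one]
    exact ht
  have heuler : ∀ᶠ t in 𝓝 (0 : ℂ), eval (γ t) (pderiv 2 (pencilDet A₁ A₂)) =
      (t * deriv x t - x t) * eval (γ t) (pderiv 0 (pencilDet A₁ A₂)) := by
    filter_upwards [hfγ, hfγ.eventually_nhds, hxa.eventually_analyticAt] with t h1 h2 h3
    have h4 := (hγ' t h3 (pencilDet A₁ A₂)).unique
      ((hasDerivAt_const t (0 : ℂ)).congr_of_eventuallyEq h2)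
    have h5 := congrArg (eval (γ t)) (isHomogeneous_pencilDet A₁ A₂).sum_X_mul_pderiv
    simp only [Fin.sum_univ_three, map_add, map_mul, eval_X, map_nsmul, h1, smul_zero] at h5
    have e0 : γ t 0 = x t := rfl
    have e1 : γ t 1 = t := rfl
    have e2 : γ t 2 = 1 := rfl
    rw [e0, e1, e2] at h5
    linear_combination h5 - t * h4
  have hca : AnalyticAt ℂ (fun t => t * deriv x t - x t) 0 :=
    (analyticAt_id.mul hxa.deriv).sub hxa
  have hgord : analyticOrderAt (fun t => eval (γ t) (pderiv 2 (pencilDet A₁ A₂))) 0 =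
      (k - 1 : ℕ) := by
    rw [analyticOrderAt_congr heuler]
    refine (analyticOrderAt_mul hca (MvPolynomial.analyticAt_eval _ hγ)).trans ?_
    rw [hord, hca.analyticOrderAt_eq_zero.2, zero_add]
    simp [hx.map_zero, hlam]
  refine exists_analytic_limitProjection (A := fun t => x t • A₁ + t • A₂) (z := 1)
    ((EntrywiseAnalyticAt.smul hxa (.const _)).add (.smul (f := fun t => t) (by fun_prop) (.const _)))
    hVU (d := fun i => 1 / lam * d i - 1) ?_ (n := k - 1) (by omega)
    (MvPolynomial.analyticAt_eval _ hγ) hgord ?_ (.of_forall fun t => ?_)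
  · have h1 : Matrix.diagonal (fun i => 1 / lam * d i - 1) = (1 / lam) • Matrix.diagonal d - 1 := by
      ext a b
      by_cases hab : a = b
      · subst hab; simp
      · simp [hab]
    rw [h1, mul_sub, sub_mul, mul_one, mul_eq_one_comm.1 hVU, Matrix.mul_smul, Matrix.smul_mul,
      ← hd, hx.map_zero]
    simp
  · filter_upwards [hfγ] with t ht
    rw [eval_pencilDet] at ht
    exact ht
  · have := (pencilDet A₁ A₂).hasDerivAt_eval (γ := fun w => ![x t, t, w]) (γ' := ![0, 0, 1])
      (t := 1) fun i => by
        fin_cases i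
        · exact hasDerivAt_const _ _
        · exact hasDerivAt_const _ _
        · exact hasDerivAt_id _
    simpa [Fin.sum_univ_three, eval_pencilDet] using this

/-- Existence of the limit projection in the chart `x₁ = 1`, where the regularity condition already
concerns `∂/∂x₃`. -/
theorem exists_limitProjection_of_isBranchAtZero (hA₁ : IsStarNormal A₁)
    (hR : IsIrreducibleFactorization (pencilDet A₁ A₂) R m)
    (hreg : RegularAt R 0) (hm : ∀ j ∈ componentsThrough R 0, m j = 1)
    (hj : j ∈ componentsThrough R 0) {x : ℂ → ℂ} (hx : IsBranchAtZero (R j) x) :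
    ∃ P : ℂ → Matrix (Fin N) (Fin N) ℂ, EntrywiseAnalyticAt P 0 ∧
      IsLimitProjection (fun t => A₁ + t • A₂ - x t • (1 : Matrix (Fin N) (Fin N) ℂ)) 0 (P 0) ∧
      ∀ᶠ t in 𝓝[≠] (0 : ℂ),
        (A₁ + t • A₂ - x t • (1 : Matrix (Fin N) (Fin N) ℂ) - (0 : ℂ) • 1) * P t = 0 ∧
        P t * (A₁ + t • A₂ - x t • (1 : Matrix (Fin N) (Fin N) ℂ) - (0 : ℂ) • 1) = 0 ∧
        P t * P t = P t := by
  obtain ⟨u, hu, hf⟩ := hR.exists_eq_unit_mul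
  obtain ⟨U, V, d, hVU, hd⟩ := exists_diagonalization hA₁
  obtain ⟨hreg1, hreg2⟩ := hreg.2 rfl
  have hb : basePoint 0 = ![1, 0, 0] := if_pos rfl
  have hxa := hx.analyticAt
  have hdx : HasDerivAt x (deriv x 0) 0 := hxa.differentiableAt.hasDerivAt
  have hI : ∀ i, i ∈ componentsThrough R 0 ↔ eval ![1, 0, 0] (R i) = 0 := fun i => by
    rw [componentsThrough, hb]; rfl
  set γ : ℂ → Fin 3 → ℂ := fun t => ![1, t, x t] with hγdef
  have hγ0 : γ 0 = ![1, 0, 0] := by simp [hγdef, hx.map_zero]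
  have hγ : ∀ i, AnalyticAt ℂ (fun t => γ t i) 0 := fun i => by
    fin_cases i <;> simp [hγdef] <;> fun_prop
  have hγ' : ∀ (p : MvPolynomial (Fin 3) ℂ), HasDerivAt (fun t => eval (γ t) p)
        (deriv x 0 * eval (γ 0) (pderiv 2 p) + eval (γ 0) (pderiv 1 p)) 0 := fun p => by
    have := p.hasDerivAt_eval (γ := γ) (γ' := ![0, 1, deriv x 0]) (t := 0) fun i => by
      fin_cases i
      · exact hasDerivAt_const _ _
      · exact hasDerivAt_id _
      · exact hdx
    simpa [Fin.sum_univ_three, add_comm] using this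
  -- The line `x₂ = 0`, on which the determinant is that of a diagonal matrix.
  set η : ℂ → Fin 3 → ℂ := fun t => ![1, 0, t] with hηdef
  have hη0 : η 0 = ![1, 0, 0] := rfl
  have hη : ∀ i, AnalyticAt ℂ (fun t => η t i) 0 := fun i => by
    fin_cases i <;> simp [hηdef] <;> fun_prop
  have hη' : ∀ (p : MvPolynomial (Fin 3) ℂ),
      HasDerivAt (fun t => eval (η t) p) (eval ![1, 0, 0] (pderiv 2 p)) 0 := fun p => by
    have := p.hasDerivAt_eval (γ := η) (γ' := ![0, 0, 1]) (t := 0) fun i => by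
      fin_cases i
      · exact hasDerivAt_const _ _
      · exact hasDerivAt_const _ _
      · exact hasDerivAt_id _
    simpa [Fin.sum_univ_three, hηdef] using this
  have hcard := card_components_eq_card_kernel (R := R) (m := m) hu hη hR.mult_pos
    (fun i hi => hm i ((hI i).2 (hη0 ▸ hi)))
    (fun i hi => by
      rw [(hη' (R i)).deriv, ← hb]
      exact hreg1 i ((hI i).2 (hη0 ▸ hi)))
    hVU (a := d) (b := fun _ => -1)
    (fun i _ => by simp)
    (fun t => by
      rw [← hf, eval_pencilDet]
      congr 1
      have h1 : Matrix.diagonal (fun i => d i + t * -1) =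
          Matrix.diagonal d - t • (1 : Matrix (Fin N) (Fin N) ℂ) := by
        ext a b
        by_cases hab : a = b
        · subst hab; simp; ring
        · simp [hab]
      rw [h1, mul_sub, sub_mul, Matrix.mul_smul, Matrix.smul_mul, mul_one,
        mul_eq_one_comm.1 hVU, ← hd]
      simp [hηdef])
  rw [hη0] at hcard
  set k := (Finset.univ.filter fun i => eval ![1, 0, 0] (R i) = 0).card with hk
  have hkpos : 0 < k := Finset.card_pos.2 ⟨j, by simpa using (hI j).1 hj⟩
  have hjt : deriv x 0 * partialAt (R j) 0 2 + partialAt (R j) 0 1 = 0 := by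
    have h1 := hγ' (R j)
    rw [hγ0, ← hb] at h1
    have h2 : (fun t => eval (γ t) (R j)) =ᶠ[𝓝 0] fun _ => 0 := hx.eval_eq_zero
    exact h1.unique ((hasDerivAt_const (0 : ℂ) (0 : ℂ)).congr_of_eventuallyEq h2)
  have hord := analyticOrderAt_eval_pderiv (R := R) (m := m) hu hγ hR.mult_pos
    (fun i hi => hm i ((hI i).2 (hγ0 ▸ hi))) (j := j) hx.eval_eq_zero
    (fun i hij hi => by
      have hi' := (hI i).2 (hγ0 ▸ hi)
      rw [(hγ' (R i)).deriv, hγ0, ← hb]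
      simpa [partialAt, add_comm] using pairing_ne_zero_of_linearIndependent (p := 1) (.inl one_ne_zero)
        (hreg2 i hi' j hj hij) (by simpa [add_comm] using hjt))
    (k := 2) (by rw [hγ0, ← hb]; exact hreg1 j hj)
  rw [hγ0, ← hk, ← hf] at hord
  refine exists_analytic_limitProjection
    (A := fun t => A₁ + t • A₂ - x t • (1 : Matrix (Fin N) (Fin N) ℂ)) (z := 0)
    (((EntrywiseAnalyticAt.const _).add (.smul (f := fun t => t) (by fun_prop) (.const _))).sub
      (.smul hxa (.const _)))
    hVU (d := d) (by simpa [hx.map_zero] using hd) (n := k - 1) (by omega)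
    (MvPolynomial.analyticAt_eval _ hγ) hord ?_ (.of_forall fun t => ?_)
  · filter_upwards [hx.eval_eq_zero] with t ht
    have h1 : eval (γ t) (pencilDet A₁ A₂) = 0 := by
      rw [hf, map_mul, map_prod, Finset.prod_eq_zero (Finset.mem_univ j), mul_zero]
      rw [map_pow, hm j hj, pow_one]
      exact ht
    rw [eval_pencilDet] at h1
    simpa [hγdef] using h1
  · have := (pencilDet A₁ A₂).hasDerivAt_eval (γ := fun w => ![1, t, x t + w]) (γ' := ![0, 0, 1])
      (t := 0) fun i => by
        fin_cases i
        · exact hasDerivAt_const _ _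
        · exact hasDerivAt_const _ _
        · exact (hasDerivAt_id _).const_add _
    simpa [Fin.sum_univ_three, eval_pencilDet, sub_sub, add_smul] using this

end Components

theorem theorem1p2 {N : ℕ} (A₁ A₂ : Matrix (Fin N) (Fin N) ℂ) (hA₁ : IsStarNormal A₁)
    {s : ℕ} (R : Fin s → MvPolynomial (Fin 3) ℂ) (m : Fin s → ℕ)
    (hR : IsIrreducibleFactorization (pencilDet A₁ A₂) R m)
    (hreg : ∀ μ ∈ spectrum ℂ A₁, RegularAt R μ)
    (lam : ℂ) (hlam : lam ∈ spectrum ℂ A₁)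
    (hm : ∀ j ∈ componentsThrough R lam, m j = 1)
    (j : Fin s) (hj : j ∈ componentsThrough R lam) :
    (lam ≠ 0 →
      (∃ x : ℂ → ℂ, IsBranch (R j) lam x) ∧
      ∀ x : ℂ → ℂ, IsBranch (R j) lam x →
        ∃ P : Matrix (Fin N) (Fin N) ℂ,
          IsLimitProjection (fun t => x t • A₁ + t • A₂) 1 P ∧
          P * A₂ * P = -(lam * deriv x 0) • P ∧
          P * A₂ * reducedResolvent A₁ lam * A₂ * P = -(iteratedDeriv 2 x 0 / 2) • P) ∧
    (lam = 0 →
      (∃ x : ℂ → ℂ, IsBranchAtZero (R j) x) ∧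
      ∀ x : ℂ → ℂ, IsBranchAtZero (R j) x →
        ∃ P : Matrix (Fin N) (Fin N) ℂ,
          IsLimitProjection (fun t => A₁ + t • A₂ - x t • (1 : Matrix (Fin N) (Fin N) ℂ)) 0 P ∧
          P * A₂ * P = deriv x 0 • P ∧
          P * A₂ * reducedResolvent A₁ 0 * A₂ * P = (iteratedDeriv 2 x 0 / 2) • P) := by
  refine ⟨fun h0 => ⟨exists_isBranch h0 hj (((hreg lam hlam).1 h0).1 j hj), fun x hx => ?_⟩, ?_⟩
  · obtain ⟨P, hPa, hPlim, hP⟩ :=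
      exists_limitProjection_of_isBranch hA₁ hR h0 (hreg lam hlam) hm hj hx
    obtain ⟨r, hra, hr0, hxr⟩ := hx.analyticAt.exists_second_order
    have hT := sub_mul_reducedResolvent_mul_sub hA₁ lam
    have hK₀ : (1 / lam) • A₁ - 1 = lam⁻¹ • (A₁ - lam • 1) := by
      rw [smul_sub, smul_smul, inv_mul_cancel₀ h0, one_smul, one_div]
    obtain ⟨hPP, hP1, hP2, hP3, hP4⟩ := limitProjection_identities
      (K₀ := (1 / lam) • A₁ - 1) (K₁ := deriv x 0 • A₁ + A₂) (K₂ := fun t => r t • A₁)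
      -- `K₀ = lam⁻¹ (A₁ - lam)`, and `-T` is a generalized inverse of `A₁ - lam`
      (S := -lam • reducedResolvent A₁ lam)
      (fun t => by rw [hxr t, hx.map_zero]; module)
      (hra.continuousAt.smul continuousAt_const) hPa hP
      (by
        rw [hK₀]
        simp only [Matrix.smul_mul, Matrix.mul_smul, hT, smul_smul, smul_neg, ← neg_smul]
        congr 1
        field_simp)
    rw [hK₀, Matrix.smul_mul, smul_eq_zero_iff_right (inv_ne_zero h0), sub_mul, Matrix.smul_mul,
      one_mul, sub_eq_zero] at hP1
    rw [hK₀, Matrix.mul_smul, smul_eq_zero_iff_right (inv_ne_zero h0), mul_sub, Matrix.mul_smul,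
      mul_one, sub_eq_zero] at hP2
    refine ⟨P 0, hPlim, ?_, ?_⟩
    · rw [mul_add, add_mul, Matrix.mul_smul, hP2, Matrix.smul_mul, Matrix.smul_mul, hPP,
        smul_smul] at hP3
      rw [eq_neg_of_add_eq_zero_right hP3, neg_smul, mul_comm]
    · have hTP := reducedResolvent_mul_eq_zero hA₁ hP1
      have hPT := mul_reducedResolvent_eq_zero hP2
      have h1 : P 0 * (deriv x 0 • A₁ + A₂) * (-lam • reducedResolvent A₁ lam) *
          (deriv x 0 • A₁ + A₂) * P 0 =
          -lam • (P 0 * A₂ * reducedResolvent A₁ lam * A₂ * P 0) := by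
        simp only [mul_add, add_mul, Matrix.mul_smul, Matrix.smul_mul, hP2, mul_assoc, hP1, hTP]
        simp only [← mul_assoc, hPT]
        simp
      rw [h1, Matrix.mul_smul, hP2, Matrix.smul_mul, Matrix.smul_mul, hPP, hr0, smul_smul] at hP4
      have h2 := congrArg (fun M => (-lam)⁻¹ • M) hP4
      simp only [smul_smul, inv_mul_cancel₀ (neg_ne_zero.2 h0), one_smul] at h2
      rw [h2]
      congr 1
      field_simp
  · rintro rfl
    refine ⟨exists_isBranchAtZero hj (((hreg 0 hlam).2 rfl).1 j hj), fun x hx => ?_⟩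
    obtain ⟨P, hPa, hPlim, hP⟩ :=
      exists_limitProjection_of_isBranchAtZero hA₁ hR (hreg 0 hlam) hm hj hx
    obtain ⟨r, hra, hr0, hxr⟩ := hx.analyticAt.exists_second_order
    have hT := sub_mul_reducedResolvent_mul_sub hA₁ 0
    rw [zero_smul, sub_zero] at hT
    obtain ⟨hPP, hP1, hP2, hP3, hP4⟩ := limitProjection_identities
      (K₀ := A₁) (K₁ := A₂ - deriv x 0 • 1) (K₂ := fun t => -r t • 1)
      (S := -reducedResolvent A₁ 0)
      (fun t => by rw [hxr t, hx.map_zero]; module)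
      (hra.continuousAt.neg.smul continuousAt_const) hPa hP
      (by rw [mul_neg, neg_mul, hT, neg_neg])
    refine ⟨P 0, hPlim, ?_, ?_⟩
    · rw [mul_sub, sub_mul, Matrix.mul_smul, mul_one, Matrix.smul_mul, hPP, sub_eq_zero] at hP3
      exact hP3
    · have hTP := reducedResolvent_mul_eq_zero hA₁ (hP1.trans (zero_smul ℂ _).symm)
      have hPT := mul_reducedResolvent_eq_zero (hP2.trans (zero_smul ℂ _).symm)
      have h1 : P 0 * (A₂ - deriv x 0 • 1) * (-reducedResolvent A₁ 0) *
          (A₂ - deriv x 0 • 1) * P 0 =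
          -(P 0 * A₂ * reducedResolvent A₁ 0 * A₂ * P 0) := by
        simp only [mul_sub, sub_mul, Matrix.mul_smul, Matrix.smul_mul, mul_one, mul_neg, neg_mul,
          mul_assoc, hTP]
        simp only [← mul_assoc, hPT]
        simp
      rw [h1, Matrix.mul_smul, mul_one, Matrix.smul_mul, hPP, hr0, neg_smul] at hP4
      exact neg_injective hP4

end
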